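/- Let $d\ge 2$ be the local dimension of a qudit and let $t\ge 1$. For a finite set $S$ of qudits let $G^{(t)}_{\mathrm{Haar}(S)}=\mathbb E_{C}\big[C^{\otimes t}\otimes (C^{*})^{\otimes t}\big]$, where $C$ is Haar-distributed on the unitary group $U\big((\mathbb C^d)^{\otimes S}\big)$ and $C^*$ is its entrywise complex conjugate. Let $\|\cdot\|_\infty$ be the largest singular value. For positive integers $m$ and $D$ put qudits at the $n=m^D$ sites of the lattice $\{1,\dots,m\}^D$, and let $G_{\mathrm{Haar}}=G^{(t)}_{\mathrm{Haar}}$ be the operator above for the set of all $n$ sites. Fix a direction $\alpha\in\{1,\dots,D\}$. A row in direction $\alpha$ is a set of $m$ sites obtained by fixing all coordinates except the $\alpha$-th, and a plane perpendicular to $\alpha$ is a set of $m^{D-1}$ sites obtained by fixing the $\alpha$-th coordinate. Let $$G_{\mathrm{Rows}(\alpha)}=\bigotimes_{r\text{ a row in direction }\alpha}G^{(t)}_{\mathrm{Haar}(r)},\qquad G_{\mathrm{Planes}(\alpha)}=\bigotimes_{p\text{ a plane perpendicular to }\alpha}G^{(t)}_{\mathrm{Haar}(p)},$$ and for $D=2$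 write $G_R=G_{\mathrm{Rows}(1)}$ and $G_C=G_{\mathrm{Rows}(2)}$. 1. (Two dimensions.) There is an absolute constant $c>0$ such that for every $t\ge 1$ there is $n_0=n_0(t)$ such that for all $d\ge 2$ and all perfect squares $n\ge n_0$, on the $\sqrt n\times\sqrt n$ lattice, $$\|G_C\,G_R-G_{\mathrm{Haar}}\|_\infty\le \frac{1}{d^{\,c\sqrt n}} .$$ 2. ($D$ dimensions.) There are absolute constants $c_0>0$ and $c>0$ such that for every $t\ge 1$ there is $n_0=n_0(t)$ such that for all $d\ge 2$, all $D\ge 1$, every direction $\alpha\in\{1,\dots,D\}$ and all $n=m^D\ge n_0$ with $D\le c_0\,\dfrac{\ln n}{\ln\ln n}$, $$\|G_{\mathrm{Planes}(\alpha)}\,G_{\mathrm{Rows}(\alpha)}-G_{\mathrm{Haar}}\|_\infty\le \frac{1}{d^{\,c\,n^{1-1/D}}} .$$ -/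

import Mathlib

open scoped Kronecker

noncomputable section

/-! ### Haar measure on the unitary group -/

section Unitary

variable (X : Type) [Fintype X] [DecidableEq X]

instance unitaryGroupCompactSpace : CompactSpace (Matrix.unitaryGroup X ℂ) := by
  refine isCompact_iff_compactSpace.mp ?_
  have hbox : IsCompact {M : Matrix X X ℂ | ∀ i, M i ∈ {r : X → ℂ | ∀ j, r j ∈
      Metric.closedBall (0 : ℂ) 1}} :=
    isCompact_pi_infinite fun _ => isCompact_pi_infinite fun _ => isCompact_closedBall 0 1
  refine hbox.of_isClosed_subset ?_ ?_
  · have : ((Matrix.unitaryGroup X ℂ : Submonoid (Matrix X X ℂ)) : Set (Matrix X X ℂ)) =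
        {M | M * star M = 1} := by
      ext M; exact Matrix.mem_unitaryGroup_iff
    rw [this]
    exact isClosed_eq (by fun_prop) continuous_const
  · intro M hM i j
    simpa using entry_norm_bound_of_unitary hM i j

instance unitaryGroupMeasurableSpace : MeasurableSpace (Matrix.unitaryGroup X ℂ) :=
  borel _

instance unitaryGroupBorelSpace : BorelSpace (Matrix.unitaryGroup X ℂ) := ⟨rfl⟩

/-- The Haar probability measure on the unitary group `U(ℂ^X)`. -/
def haarUnitary : MeasureTheory.Measure (Matrix.unitaryGroup X ℂ) :=
  MeasureTheory.Measure.haarMeasure ⊤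

end Unitary

/-! ### Moments and quasi-projectors -/

section Moments

variable {X : Type} [Fintype X] [DecidableEq X]

/-- The tensor power `C^{⊗ t}`. -/
def tensorPower (t : ℕ) (C : Matrix X X ℂ) : Matrix (Fin t → X) (Fin t → X) ℂ :=
  Matrix.of fun i j => ∏ s, C (i s) (j s)

/-- `C^{⊗ t, t} = C^{⊗ t} ⊗ (C^*)^{⊗ t}`, where `C^*` is the entrywise complex conjugate. -/
def balancedPower (t : ℕ) (C : Matrix X X ℂ) :
    Matrix ((Fin t → X) × (Fin t → X)) ((Fin t → X) × (Fin t → X)) ℂ :=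
  tensorPower t C ⊗ₖ tensorPower t (C.map star)

/-- The quasi-projector `E_{C ∼ μ} [C^{⊗ t, t}]` (the expectation is taken entrywise). -/
def quasiProjector (t : ℕ) (μ : MeasureTheory.Measure (Matrix.unitaryGroup X ℂ)) :
    Matrix ((Fin t → X) × (Fin t → X)) ((Fin t → X) × (Fin t → X)) ℂ :=
  Matrix.of fun a b => ∫ C, balancedPower t (C : Matrix X X ℂ) a b ∂μ

/-- The Schatten `∞`-norm: the largest singular value, i.e. the operator norm with respect to the
Euclidean norm. -/
def schattenInfNorm {Y : Type} [Fintype Y] [DecidableEq Y] (A : Matrix Y Y ℂ) : ℝ :=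
  ‖Matrix.toEuclideanCLM (n := Y) (𝕜 := ℂ) A‖

end Moments

/-! ### Qudits on a set of sites -/

section Qudits

/-- Labels of the computational basis of `t` copies of `(ℂ^d)^{⊗ V}` and of `t` conjugate copies. -/
abbrev MomentIndex (d t : ℕ) (V : Type) : Type :=
  (Fin t → V → Fin d) × (Fin t → V → Fin d)

/-- The part of a basis label that belongs to the sites in `S`. -/
def MomentIndex.restrict {d t : ℕ} {V : Type} (a : MomentIndex d t V) (S : V → Prop) :
    MomentIndex d t {v // S v} :=
  (fun s v => a.1 s v, fun s v => a.2 s v)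

variable (d t : ℕ) (V : Type) [Fintype V] [DecidableEq V]

/-- `G_Haar^{(t)}`: the Haar `t`-th moment projector on all the qudits in `V`. -/
def haarProjector : Matrix (MomentIndex d t V) (MomentIndex d t V) ℂ :=
  quasiProjector t (haarUnitary (V → Fin d))

variable {V} {ι : Type} [Fintype ι] [DecidableEq ι]

/-- The sites `V` are partitioned into the blocks `f ⁻¹ {k}`, and the Haar `t`-th moment projector
is applied independently to every block: this is `⨂ₖ G_Haar(f ⁻¹ {k})^{(t)}`, equivalently the
product of the (commuting) projectors `G_Haar(f ⁻¹ {k})^{(t)}` extended by the identity, written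
out in the computational basis. -/
def haarProjectorOnBlocks (f : V → ι) :
    Matrix (MomentIndex d t V) (MomentIndex d t V) ℂ :=
  Matrix.of fun a b => ∏ k : ι,
    haarProjector d t {v // f v = k} (a.restrict fun v => f v = k) (b.restrict fun v => f v = k)

end Qudits

/-! ### Lattices -/

section Lattice

/-- The `D`-dimensional lattice of side length `m`, with `n = m ^ D` sites. -/
abbrev QuditLattice (D m : ℕ) : Type := Fin D → Fin m

variable (d t : ℕ) {D : ℕ} (m : ℕ) (α : Fin D)

/-- `G_{Rows(α,n)}`: the Haar projector applied to every row in direction `α`. Two sites lie in the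
same row when all their coordinates other than the `α`-th agree; there are `m ^ (D - 1)` rows of
`m` sites each. -/
def rowsProjector : Matrix (MomentIndex d t (QuditLattice D m)) (MomentIndex d t (QuditLattice D m)) ℂ :=
  haarProjectorOnBlocks d t (fun (x : QuditLattice D m) (β : {β : Fin D // β ≠ α}) => x β)

/-- `G_{Planes(α)}`: the Haar projector applied to every `(D - 1)`-dimensional sub-lattice
perpendicular to direction `α`. Two sites lie in the same plane when their `α`-th coordinates
agree; there are `m` planes of `m ^ (D - 1)` sites each. -/
def planesProjector : Matrix (MomentIndex d t (QuditLattice D m)) (MomentIndex d t (QuditLattice D m)) ℂ :=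
  haarProjectorOnBlocks d t (fun x : QuditLattice D m => x α)

/-- `G_R` on the two-dimensional lattice: rows are the lines in the first direction. -/
def projR : Matrix (MomentIndex d t (QuditLattice 2 m)) (MomentIndex d t (QuditLattice 2 m)) ℂ :=
  rowsProjector d t m (0 : Fin 2)

/-- `G_C` on the two-dimensional lattice: columns are the lines in the second direction. -/
def projC : Matrix (MomentIndex d t (QuditLattice 2 m)) (MomentIndex d t (QuditLattice 2 m)) ℂ :=
  rowsProjector d t m (1 : Fin 2)

end Lattice

end

set_option linter.unusedSectionVars false

/-! ### Combinatorics of configurations of colours -/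

section Combinatorics

/-! Both statements concern two transversal partitions of the sites: `f` has `M` blocks (rows) of
size `m`, `g` has `m` blocks (planes or columns) of size `M`, and a row meets a plane in exactly one
site. Write `q = 1/d` and `T = t!`.

If `t` is at most the dimension of the space carried by a block, the commutant of `U^{⊗ t}` is
spanned by permutations (`exists_eq_sum_permOperator`), so the Haar projector of that block projects
onto the span of the permutation states. Hence the row projector `Q` has range spanned by product
states `ψ σ`, with one permutation per row, the plane projector `P` has range spanned by states `φ
τ`, with one permutation per plane, and the global projector `H` has range spanned by the constant
configurations, which belong to both families. An overlap of normalized states is a product over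
sites, with factor 1 where the permutations agree and at most `q` elsewhere
(`norm_inner_pairingState_le`). Each family is therefore almost orthonormal, and coefficients are
controlled by norms (`sum_norm_sq_le_of_gram`).

For `w = (P Q - H) z` one has `‖w‖² = ⟪P w, (Q - H) z⟫`. The vector `(Q - H) z` is orthogonal to the
constant states, so only nonconstant `τ` contribute, and Cauchy–Schwarz gives `‖P Q - H‖ ≤ 4 √F`,
where `F` bounds the total squared overlap of the nonconstant `φ τ` with all `ψ σ`
(`norm_mul_sub_le_of_overlaps`).

For fixed `τ` the sum over `σ` is an `M`-th power of a sum over one permutation, dominated by the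
permutation that `τ` uses most (`sum_nonconst_prod_ite_le`). A nonconstant `τ` costs at least
`q^(2M)`; half of this exponent absorbs the factor `2^M`, leaving `F ≤ 3 T² M q^M` and finally
`d^(-M/4)`. All this needs `d^m` to dominate `M`, which the bound on the dimension `D` guarantees,
since it forces `m ≥ (ln n)²`. -/

theorem sum_prod_eq_pow {ι P : Type*} [Fintype ι] [DecidableEq ι] [Fintype P] (h : P → ℝ) :
    ∑ σ : ι → P, ∏ i, h (σ i) = (∑ π, h π) ^ Fintype.card ι := by
  classical
  rw [← Finset.card_univ, ← Finset.prod_const, Finset.prod_univ_sum, Fintype.piFinset_univ]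

/-- The weights `r ^ #{i | σ i ≠ σ' i}` of all configurations other than `σ'` itself. -/
theorem sum_ne_prod_ite_le {ι P : Type*} [Fintype ι] [DecidableEq ι] [Fintype P] [DecidableEq P]
    (σ : ι → P) {r : ℝ} (hr : 0 ≤ r) :
    ∑ σ' ∈ Finset.univ.erase σ, ∏ i, (if σ i = σ' i then 1 else r) ≤
      (1 + Fintype.card P * r) ^ Fintype.card ι - 1 := by
  have h1 : ∑ σ' : ι → P, ∏ i, (if σ i = σ' i then 1 else r) ≤
      (1 + Fintype.card P * r) ^ Fintype.card ι := by
    have := Finset.prod_univ_sum (fun _ : ι => (Finset.univ : Finset P))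
      (fun i π => if σ i = π then (1 : ℝ) else r)
    rw [Fintype.piFinset_univ] at this
    rw [← this, ← Finset.card_univ (α := ι), ← Finset.prod_const]
    refine Finset.prod_le_prod (fun i _ => Finset.sum_nonneg fun π _ => by split_ifs <;> simp [hr])
      fun i _ => ?_
    calc ∑ π, (if σ i = π then (1 : ℝ) else r) ≤ ∑ π, ((if σ i = π then 1 else 0) + r) :=
          Finset.sum_le_sum fun π _ => by split_ifs <;> simp [hr]
      _ = _ := by simp [Finset.sum_add_distrib]
  have h2 := Finset.add_sum_erase Finset.univ
    (fun σ' : ι → P => ∏ i, (if σ i = σ' i then (1 : ℝ) else r)) (Finset.mem_univ σ)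
  simp only [if_true, Finset.prod_const_one] at h2
  linarith

theorem prod_ite_eq_pow_card {κ P : Type*} [Fintype κ] [DecidableEq P] (τ : κ → P) (π : P)
    (r : ℝ) : ∏ k, (if τ k = π then 1 else r) = r ^ (Finset.univ.filter fun k => τ k ≠ π).card := by
  rw [Finset.prod_ite]; simp

/-- For a fixed configuration `τ`, the colour that `τ` uses most dominates. -/
theorem sum_prod_ite_pow_le {κ P : Type*} [Fintype κ] [DecidableEq κ] [Fintype P] [DecidableEq P]
    [Nonempty P] (τ : κ → P) (M : ℕ) {q : ℝ} (hq : 0 ≤ q) (hq1 : q ≤ 1) :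
    (∑ π, ∏ k, (if τ k = π then 1 else q ^ 2)) ^ M ≤
      2 ^ M * (∑ π, ∏ k, (if τ k = π then 1 else (q ^ 2) ^ M)) +
      2 ^ M * (Fintype.card P * q ^ Fintype.card κ) ^ M := by
  set h : P → ℕ := fun π => (Finset.univ.filter fun k => τ k ≠ π).card with hh
  simp only [prod_ite_eq_pow_card]
  obtain ⟨p, -, hp⟩ := Finset.exists_min_image Finset.univ h Finset.univ_nonempty
  -- No index carries both `π` and `p`, so the two mismatch counts add up to at least `|κ|`; as `p`
  -- has the smaller count, that of `π` is at least half of `|κ|`.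
  have hoth : ∀ π, π ≠ p → Fintype.card κ ≤ 2 * h π := by
    intro π hπ
    have h1 : Fintype.card κ ≤ h π + h p := by
      rw [← Finset.card_univ]
      refine (Finset.card_le_card fun k _ => ?_).trans (Finset.card_union_le _ _)
      by_cases hk : τ k = π
      · simp [hk, hπ]
      · simp [hk]
    have := hp π (Finset.mem_univ _)
    omega
  have hsum : ∑ π, (q ^ 2) ^ h π ≤ (q ^ 2) ^ h p + Fintype.card P * q ^ Fintype.card κ := by
    calc ∑ π, (q ^ 2) ^ h π
        ≤ ∑ π, ((if p = π then (q ^ 2) ^ h p else 0) + q ^ Fintype.card κ) := by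
          refine Finset.sum_le_sum fun π _ => ?_
          split_ifs with hπ
          · subst hπ; simp [pow_nonneg hq]
          · rw [← pow_mul, zero_add]
            exact pow_le_pow_of_le_one hq hq1 (hoth π (Ne.symm hπ))
      _ = _ := by simp [Finset.sum_add_distrib]
  have hb : 0 ≤ Fintype.card P * q ^ Fintype.card κ := by positivity
  calc (∑ π, (q ^ 2) ^ h π) ^ M
      ≤ ((q ^ 2) ^ h p + Fintype.card P * q ^ Fintype.card κ) ^ M :=
        pow_le_pow_left₀ (by positivity) hsum M
    _ ≤ 2 ^ (M - 1) * (((q ^ 2) ^ h p) ^ M + (Fintype.card P * q ^ Fintype.card κ) ^ M) :=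
        add_pow_le (by positivity) hb M
    _ ≤ 2 ^ M * (((q ^ 2) ^ h p) ^ M + (Fintype.card P * q ^ Fintype.card κ) ^ M) := by
        gcongr
        · norm_num
        · omega
    _ ≤ _ := by
        rw [mul_add]
        gcongr
        rw [← pow_mul, mul_comm (h p), pow_mul]
        exact Finset.single_le_sum (f := fun π => ((q ^ 2) ^ M) ^ h π)
          (fun π _ => by positivity) (Finset.mem_univ p)

/-- The total squared overlap of the nonconstant configurations on `κ` with all the
configurations on `ι`. -/
theorem sum_nonconst_prod_ite_le {ι κ P : Type*} [Fintype ι] [DecidableEq ι] [Fintype κ]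
    [DecidableEq κ] [Fintype P] [DecidableEq P] [Nonempty P] {q : ℝ} (hq : 0 ≤ q) (hq1 : q ≤ 1)
    (S : Finset (κ → P)) (hS : ∀ τ ∈ S, ∀ π : P, τ ≠ Function.const κ π) :
    ∑ τ ∈ S, ∑ σ : ι → P, ∏ i, ∏ k, (if τ k = σ i then 1 else q ^ 2) ≤
      2 ^ Fintype.card ι * (Fintype.card P * ((1 + Fintype.card P * (q ^ 2) ^ Fintype.card ι) ^
        Fintype.card κ - 1)) + Fintype.card P ^ Fintype.card κ *
        (2 ^ Fintype.card ι * (Fintype.card P * q ^ Fintype.card κ) ^ Fintype.card ι) := by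
  set M := Fintype.card ι
  have h1 : ∀ τ : κ → P, ∑ σ : ι → P, ∏ i, ∏ k, (if τ k = σ i then 1 else q ^ 2) =
      (∑ π, ∏ k, (if τ k = π then 1 else q ^ 2)) ^ M := fun τ =>
    sum_prod_eq_pow fun π => ∏ k, (if τ k = π then 1 else q ^ 2)
  simp only [h1]
  refine (Finset.sum_le_sum fun τ _ => sum_prod_ite_pow_le τ M hq hq1).trans ?_
  rw [Finset.sum_add_distrib]
  refine add_le_add ?_ ?_
  -- With the sums exchanged, each `π` sees every configuration except the constant one at `π`; that
  -- omission is what subtracts the 1.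
  · rw [← Finset.mul_sum, Finset.sum_comm]
    refine mul_le_mul_of_nonneg_left ?_ (by positivity)
    rw [← Finset.card_univ (α := P), ← nsmul_eq_mul]
    refine Finset.sum_le_card_nsmul _ _ _ fun π _ => ?_
    rw [Finset.card_univ]
    refine le_trans ?_ (sum_ne_prod_ite_le (Function.const κ π) (r := (q ^ 2) ^ M) (by positivity))
    simp only [Function.const_apply, eq_comm (a := π)]
    refine Finset.sum_le_sum_of_subset_of_nonneg (fun τ hτ => ?_) fun τ _ _ =>
      Finset.prod_nonneg fun k _ => by split_ifs <;> positivity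
    exact Finset.mem_erase.2 ⟨hS τ hτ π, Finset.mem_univ _⟩
  · rw [Finset.sum_const, nsmul_eq_mul]
    refine mul_le_mul_of_nonneg_right ?_ (by positivity)
    have := Finset.card_le_univ S
    rw [Fintype.card_fun] at this
    exact_mod_cast this

end Combinatorics

/-! ### Almost orthonormal families -/

section AlmostOrthonormal

variable {E : Type*} [NormedAddCommGroup E] [InnerProductSpace ℂ E]

/-- Diagonal dominance of the Gram matrix bounds the coefficients by the norm. -/
theorem sum_norm_sq_le_of_gram {S : Type*} [Fintype S] [DecidableEq S] (ψ : S → E)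
    (h1 : ∀ s, ‖ψ s‖ = 1)
    (hoff : ∀ s, ∑ s' ∈ Finset.univ.erase s, ‖inner ℂ (ψ s) (ψ s')‖ ≤ 1 / 2) (c : S → ℂ) :
    ∑ s, ‖c s‖ ^ 2 ≤ 2 * ‖∑ s, c s • ψ s‖ ^ 2 := by
  set K : S → S → ℝ := fun s s' => ‖inner ℂ (ψ s) (ψ s')‖ with hK
  have hKsymm : ∀ s s', K s s' = K s' s := fun s s' => norm_inner_symm _ _
  have hx : (‖∑ s, c s • ψ s‖ : ℂ) ^ 2 =
      ∑ s, ((‖c s‖ : ℂ) ^ 2 + ∑ s' ∈ Finset.univ.erase s,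
        (starRingEnd ℂ) (c s) * (c s' * inner ℂ (ψ s) (ψ s'))) := by
    have h := inner_self_eq_norm_sq_to_K (𝕜 := ℂ) (∑ s, c s • ψ s)
    refine h.symm.trans ?_
    rw [sum_inner]
    refine Finset.sum_congr rfl fun s _ => ?_
    rw [inner_sum, ← Finset.add_sum_erase _ _ (Finset.mem_univ s)]
    congr 1
    · rw [inner_smul_left, inner_smul_right, inner_self_eq_norm_sq_to_K, h1, ← mul_assoc,
        Complex.conj_mul']
      simp
    · exact Finset.sum_congr rfl fun s' _ => by rw [inner_smul_left, inner_smul_right]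
  have hre : ‖∑ s, c s • ψ s‖ ^ 2 = ∑ s, (‖c s‖ ^ 2 + ∑ s' ∈ Finset.univ.erase s,
        ((starRingEnd ℂ) (c s) * (c s' * inner ℂ (ψ s) (ψ s'))).re) := by
    have := congrArg Complex.re hx
    simp only [Complex.re_sum, Complex.add_re] at this
    exact_mod_cast this
  -- AM–GM on each off-diagonal term. Since `K` is symmetric, both halves reduce to the same row
  -- sums, each at most 1/2.
  have hterm : ∀ s s', -((‖c s‖ ^ 2 + ‖c s'‖ ^ 2) / 2 * K s s') ≤
      ((starRingEnd ℂ) (c s) * (c s' * inner ℂ (ψ s) (ψ s'))).re := by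
    intro s s'
    have h2 := Complex.abs_re_le_norm ((starRingEnd ℂ) (c s) * (c s' * inner ℂ (ψ s) (ψ s')))
    rw [norm_mul, norm_mul, RCLike.norm_conj, ← mul_assoc ‖c s‖] at h2
    have h3 : ‖c s‖ * ‖c s'‖ * K s s' ≤ (‖c s‖ ^ 2 + ‖c s'‖ ^ 2) / 2 * K s s' :=
      mul_le_mul_of_nonneg_right (by nlinarith [sq_nonneg (‖c s‖ - ‖c s'‖)]) (norm_nonneg _)
    linarith [neg_abs_le ((starRingEnd ℂ) (c s) * (c s' * inner ℂ (ψ s) (ψ s'))).re]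
  have hsw : ∑ s, ∑ s' ∈ Finset.univ.erase s, ‖c s'‖ ^ 2 * K s s' =
      ∑ s, ∑ s' ∈ Finset.univ.erase s, ‖c s‖ ^ 2 * K s s' := by
    rw [Finset.sum_comm' (t' := Finset.univ) (s' := fun s' => Finset.univ.erase s')
      (by simp [eq_comm])]
    exact Finset.sum_congr rfl fun s _ => Finset.sum_congr rfl fun s' _ => by rw [hKsymm]
  have hoff' : ∑ s, ∑ s' ∈ Finset.univ.erase s, ‖c s‖ ^ 2 * K s s' ≤
      ∑ s, ‖c s‖ ^ 2 * (1 / 2) := by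
    refine Finset.sum_le_sum fun s _ => ?_
    rw [← Finset.mul_sum]
    exact mul_le_mul_of_nonneg_left (hoff s) (by positivity)
  have hlow : ∑ s, (‖c s‖ ^ 2 + ∑ s' ∈ Finset.univ.erase s,
      -((‖c s‖ ^ 2 + ‖c s'‖ ^ 2) / 2 * K s s')) ≤ ‖∑ s, c s • ψ s‖ ^ 2 := by
    rw [hre]
    gcongr with s _ s' _
    exact hterm s s'
  have heq : ∑ s, (‖c s‖ ^ 2 + ∑ s' ∈ Finset.univ.erase s,
      -((‖c s‖ ^ 2 + ‖c s'‖ ^ 2) / 2 * K s s')) = ∑ s, ‖c s‖ ^ 2 -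
      (1 / 2) * ((∑ s, ∑ s' ∈ Finset.univ.erase s, ‖c s‖ ^ 2 * K s s') +
        ∑ s, ∑ s' ∈ Finset.univ.erase s, ‖c s'‖ ^ 2 * K s s') := by
    rw [← Finset.sum_add_distrib, Finset.mul_sum, ← Finset.sum_sub_distrib]
    refine Finset.sum_congr rfl fun s _ => ?_
    rw [← Finset.sum_add_distrib, Finset.mul_sum, sub_eq_add_neg, ← Finset.sum_neg_distrib]
    congr 1
    exact Finset.sum_congr rfl fun s' _ => by ring
  rw [heq, hsw] at hlow
  rw [← Finset.sum_mul] at hoff'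
  linarith

/-- If `y` is orthogonal to the vectors `φ τ` with `τ ∉ R`, only the overlaps of the `ψ σ` with the
`φ τ`, `τ ∈ R`, contribute to `⟪x, y⟫`. -/
theorem norm_inner_le_of_overlaps {S R : Type*} [Fintype S] [Fintype R] (ψ : S → E) (φ : R → E)
    (x : R → ℂ) (y : S → ℂ) (N : Finset R)
    (hy : ∀ τ ∉ N, inner ℂ (φ τ) (∑ s, y s • ψ s) = 0) {F : ℝ}
    (hF : ∑ τ ∈ N, ∑ s, ‖inner ℂ (φ τ) (ψ s)‖ ^ 2 ≤ F)
    (hx2 : ∑ τ, ‖x τ‖ ^ 2 ≤ 2 * ‖∑ τ, x τ • φ τ‖ ^ 2)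
    (hy2 : ∑ s, ‖y s‖ ^ 2 ≤ 2 * ‖∑ s, y s • ψ s‖ ^ 2) :
    ‖inner ℂ (∑ τ, x τ • φ τ) (∑ s, y s • ψ s)‖ ≤
      2 * √F * ‖∑ τ, x τ • φ τ‖ * ‖∑ s, y s • ψ s‖ := by
  classical
  have hF0 : 0 ≤ F := le_trans (by positivity) hF
  have h1 : inner ℂ (∑ τ, x τ • φ τ) (∑ s, y s • ψ s) =
      ∑ p ∈ N ×ˢ (Finset.univ : Finset S),
        (starRingEnd ℂ) (x p.1) * y p.2 * inner ℂ (φ p.1) (ψ p.2) := by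
    rw [sum_inner, Finset.sum_product, ← Finset.sum_subset (Finset.subset_univ N)]
    · refine Finset.sum_congr rfl fun τ _ => ?_
      rw [inner_smul_left, inner_sum, Finset.mul_sum]
      exact Finset.sum_congr rfl fun s _ => by rw [inner_smul_right]; ring
    · intro τ _ hτ
      rw [inner_smul_left, hy τ hτ, mul_zero]
  have h2 : ‖inner ℂ (∑ τ, x τ • φ τ) (∑ s, y s • ψ s)‖ ≤
      ∑ p ∈ N ×ˢ (Finset.univ : Finset S), (‖x p.1‖ * ‖y p.2‖) * ‖inner ℂ (φ p.1) (ψ p.2)‖ := by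
    rw [h1]
    refine (norm_sum_le _ _).trans (le_of_eq (Finset.sum_congr rfl fun p _ => ?_))
    rw [norm_mul, norm_mul, RCLike.norm_conj]
  have h3 := Finset.sum_mul_sq_le_sq_mul_sq (N ×ˢ (Finset.univ : Finset S))
    (fun p => ‖x p.1‖ * ‖y p.2‖) (fun p => ‖inner ℂ (φ p.1) (ψ p.2)‖)
  have h4 : ∑ p ∈ N ×ˢ (Finset.univ : Finset S), (‖x p.1‖ * ‖y p.2‖) ^ 2 ≤
      (2 * ‖∑ τ, x τ • φ τ‖ ^ 2) * (2 * ‖∑ s, y s • ψ s‖ ^ 2) := by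
    rw [Finset.sum_product]
    simp only [mul_pow]
    rw [← Finset.sum_mul_sum]
    refine mul_le_mul (le_trans ?_ hx2) hy2 (by positivity) (by positivity)
    exact Finset.sum_le_sum_of_subset_of_nonneg (Finset.subset_univ N) fun _ _ _ => by positivity
  have h5 : ∑ p ∈ N ×ˢ (Finset.univ : Finset S), ‖inner ℂ (φ p.1) (ψ p.2)‖ ^ 2 ≤ F := by
    rwa [Finset.sum_product]
  refine h2.trans (le_of_sq_le_sq ?_ (by positivity))
  refine h3.trans ((mul_le_mul h4 h5 (by positivity) (by positivity)).trans (le_of_eq ?_))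
  rw [mul_pow, mul_pow, mul_pow, Real.sq_sqrt hF0]
  ring

end AlmostOrthonormal

/-! ### Tensor powers and permutation operators -/

section TensorPowers

open Matrix

variable {X : Type} [Fintype X] [DecidableEq X] {t : ℕ}

theorem tensorPower_mul (A B : Matrix X X ℂ) :
    tensorPower t (A * B) = tensorPower t A * tensorPower t B := by
  ext i j
  simp only [tensorPower, of_apply, mul_apply]
  rw [Finset.prod_univ_sum, Fintype.piFinset_univ]
  exact Finset.sum_congr rfl fun k _ => Finset.prod_mul_distrib

theorem tensorPower_diagonal (w : X → ℂ) :
    tensorPower t (diagonal w) = diagonal fun i => ∏ s, w (i s) := by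
  ext i j
  simp only [tensorPower, of_apply, diagonal_apply]
  split_ifs with h
  · subst h; simp
  · obtain ⟨s, hs⟩ := Function.ne_iff.1 h
    exact Finset.prod_eq_zero (Finset.mem_univ s) (if_neg hs)

theorem tensorPower_one : tensorPower t (1 : Matrix X X ℂ) = 1 := by
  rw [← diagonal_one, tensorPower_diagonal]; simp

theorem tensorPower_conjTranspose (A : Matrix X X ℂ) :
    tensorPower t Aᴴ = (tensorPower t A)ᴴ := by
  ext i j
  simp [tensorPower]

theorem tensorPower_map_star (A : Matrix X X ℂ) :
    tensorPower t (A.map star) = (tensorPower t A).map star := by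
  ext i j
  simp [tensorPower]

theorem balancedPower_mul (A B : Matrix X X ℂ) :
    balancedPower t (A * B) = balancedPower t A * balancedPower t B := by
  have h : (A * B).map star = A.map star * B.map star := by
    ext i j; simp [mul_apply]
  rw [balancedPower, h, tensorPower_mul, tensorPower_mul, mul_kronecker_mul]
  rfl

theorem balancedPower_conjTranspose (A : Matrix X X ℂ) :
    balancedPower t Aᴴ = (balancedPower t A)ᴴ := by
  have h : Aᴴ.map star = (A.map star)ᴴ := by
    ext i j; simp
  rw [balancedPower, balancedPower, h, tensorPower_conjTranspose, tensorPower_conjTranspose,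
    conjTranspose_kronecker]

/-- Applying `C^{⊗ t, t}` to a vector is conjugating the corresponding matrix by `C^{⊗ t}`. -/
theorem balancedPower_mulVec (C : Matrix X X ℂ) (x : (Fin t → X) × (Fin t → X) → ℂ) :
    of (fun i j => (balancedPower t C *ᵥ x) (i, j)) =
      tensorPower t C * of (fun i j => x (i, j)) * (tensorPower t C)ᴴ := by
  ext i j
  simp only [of_apply, mulVec, dotProduct, balancedPower, Fintype.sum_prod_type, mul_apply,
    kroneckerMap_apply, conjTranspose_apply, Finset.sum_mul, tensorPower_map_star, map_apply]
  rw [Finset.sum_comm]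
  exact Finset.sum_congr rfl fun k _ => Finset.sum_congr rfl fun l _ => by ring

/-- The operator on `t` tensor factors that permutes the factors by `σ`. -/
def permOperator (X : Type) [DecidableEq X] {t : ℕ} (σ : Equiv.Perm (Fin t)) :
    Matrix (Fin t → X) (Fin t → X) ℂ :=
  of fun i j => if i = j ∘ σ then 1 else 0

theorem tensorPower_mul_permOperator (C : Matrix X X ℂ) (σ : Equiv.Perm (Fin t)) :
    tensorPower t C * permOperator X σ = permOperator X σ * tensorPower t C := by
  ext i j
  have h : ∀ k : Fin t → X, i = k ∘ σ ↔ k = i ∘ σ.symm := fun k => by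
    rw [Equiv.eq_comp_symm, eq_comm]
  simp only [mul_apply, permOperator, of_apply, tensorPower, h, mul_ite, mul_one, mul_zero,
    ite_mul, one_mul, zero_mul, Finset.sum_ite_eq', Finset.mem_univ, if_true,
    Function.comp_apply]
  exact Fintype.prod_equiv σ _ _ fun s => by simp

/-- Operators that commute with `g^{⊗ t}`. -/
def CommutesWithPower (A : Matrix (Fin t → X) (Fin t → X) ℂ) (g : Matrix X X ℂ) : Prop :=
  tensorPower t g * A = A * tensorPower t g

theorem CommutesWithPower.mul {A : Matrix (Fin t → X) (Fin t → X) ℂ} {g h : Matrix X X ℂ}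
    (hg : CommutesWithPower A g) (hh : CommutesWithPower A h) : CommutesWithPower A (g * h) := by
  unfold CommutesWithPower at *
  rw [tensorPower_mul, mul_assoc, hh, ← mul_assoc, hg, mul_assoc]

/-- The number of tensor factors that carry the label `x`. -/
def labelCount (i : Fin t → X) (x : X) : ℕ := (Finset.univ.filter fun s => i s = x).card

theorem prod_eq_prod_pow_labelCount (i : Fin t → X) (w : X → ℂ) :
    ∏ s, w (i s) = ∏ x, w x ^ labelCount i x := by
  rw [← Finset.prod_fiberwise_of_maps_to (g := i) (t := Finset.univ) fun _ _ => Finset.mem_univ _]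
  refine Finset.prod_congr rfl fun x _ => ?_
  rw [labelCount, ← Finset.prod_const]
  exact Finset.prod_congr rfl fun s hs => by rw [(Finset.mem_filter.1 hs).2]

theorem labelCount_lt (i : Fin t → X) (x : X) : labelCount i x < t + 1 :=
  Nat.lt_succ_of_le ((Finset.card_le_univ _).trans (by simp))

variable {A : Matrix (Fin t → X) (Fin t → X) ℂ}

/-- Commuting with the diagonal unitaries forces weights to be preserved. -/
theorem labelCount_eq_of_commutes
    (hA : ∀ U ∈ Matrix.unitaryGroup X ℂ, CommutesWithPower A U) {i j : Fin t → X}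
    (hij : A i j ≠ 0) : labelCount i = labelCount j := by
  funext x
  -- A label occurs at most `t` times, so the powers of a primitive `(t + 1)`-th root of unity
  -- determine its count.
  set z := Complex.exp (2 * Real.pi * Complex.I / ((t + 1 : ℕ) : ℂ)) with hz
  have hprim : IsPrimitiveRoot z (t + 1) := Complex.isPrimitiveRoot_exp (t + 1) (by simp)
  have hnorm : ‖z‖ = 1 := hprim.norm'_eq_one (by simp)
  obtain ⟨w, hw⟩ : ∃ w : X → ℂ, ∀ y, w y = if y = x then z else 1 := ⟨_, fun _ => rfl⟩
  have hU : diagonal w ∈ Matrix.unitaryGroup X ℂ := by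
    rw [Matrix.mem_unitaryGroup_iff, star_eq_conjTranspose, diagonal_conjTranspose,
      diagonal_mul_diagonal, ← diagonal_one]
    congr 1
    funext y
    rw [Pi.star_apply, Complex.star_def, Complex.mul_conj', hw]
    split_ifs <;> simp [hnorm]
  have h := congrFun (congrFun (hA _ hU) i) j
  rw [tensorPower_diagonal, diagonal_mul, mul_diagonal, mul_comm] at h
  have h2 : ∏ s, w (i s) = ∏ s, w (j s) := mul_left_cancel₀ hij h
  rw [prod_eq_prod_pow_labelCount, prod_eq_prod_pow_labelCount] at h2
  simp only [hw, ite_pow, one_pow, Finset.prod_ite_eq',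
    Finset.mem_univ, if_true] at h2
  exact hprim.pow_inj (labelCount_lt i x) (labelCount_lt j x) h2

/-- `A` connects only labelings of equal weight, and on these the power of a diagonal matrix acts by
the same scalar, unitary or not. -/
theorem commutes_diagonal (hA : ∀ U ∈ Matrix.unitaryGroup X ℂ, CommutesWithPower A U)
    (w : X → ℂ) : CommutesWithPower A (diagonal w) := by
  unfold CommutesWithPower
  ext i j
  rw [tensorPower_diagonal, diagonal_mul, mul_diagonal, mul_comm]
  by_cases hij : A i j = 0
  · simp [hij]
  · rw [prod_eq_prod_pow_labelCount, prod_eq_prod_pow_labelCount,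
      labelCount_eq_of_commutes hA hij]

theorem commutes_hermitian (hA : ∀ U ∈ Matrix.unitaryGroup X ℂ, CommutesWithPower A U)
    {H : Matrix X X ℂ} (hH : H.IsHermitian) : CommutesWithPower A H := by
  have h := hH.spectral_theorem
  rw [Unitary.conjStarAlgAut_apply] at h
  rw [h]
  exact ((hA _ hH.eigenvectorUnitary.2).mul (commutes_diagonal hA _)).mul
    (hA _ (star hH.eigenvectorUnitary).2)

/-- An operator that commutes with `U^{⊗ t}` for unitary `U` commutes with all `g^{⊗ t}`. -/
theorem commutes_of_commutes_unitary
    (hA : ∀ U ∈ Matrix.unitaryGroup X ℂ, CommutesWithPower A U) (g : Matrix X X ℂ) :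
    CommutesWithPower A g := by
  set H : Matrix X X ℂ := (1 / 2 : ℂ) • (g + gᴴ) with hH
  set K : Matrix X X ℂ := (-Complex.I / 2) • (g - gᴴ) with hK
  have hHh : H.IsHermitian := by
    ext i j
    simp [hH]; ring
  have hKh : K.IsHermitian := by
    ext i j
    simp [hK]; ring
  have hg : g = H + Complex.I • K := by
    ext i j
    simp only [hH, hK, Matrix.add_apply, Matrix.smul_apply, Matrix.sub_apply, conjTranspose_apply, smul_eq_mul]
    linear_combination (1 / 2 * (g i j - star (g j i))) * Complex.I_sq
  have hreal : ∀ r : ℝ, CommutesWithPower A (H + (r : ℂ) • K) := fun r => by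
    refine commutes_hermitian hA (hHh.add ?_)
    ext i j
    have := congrFun (congrFun hKh i) j
    simp only [conjTranspose_apply, Matrix.smul_apply, smul_eq_mul, star_mul', Complex.star_def,
      Complex.conj_ofReal] at this ⊢
    rw [this]
  unfold CommutesWithPower
  ext i j
  -- For a fixed entry, the commutator with the power of `H + z K` is a polynomial in `z`. It
  -- vanishes for real `z`, where the matrix is Hermitian, hence also at `z = i`, where the matrix
  -- is `g`.
  set p : Polynomial ℂ :=
    ∑ k, (∏ s, (Polynomial.C (H (i s) (k s)) + Polynomial.X * Polynomial.C (K (i s) (k s)))) *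
        Polynomial.C (A k j) -
      ∑ k, Polynomial.C (A i k) *
        ∏ s, (Polynomial.C (H (k s) (j s)) + Polynomial.X * Polynomial.C (K (k s) (j s))) with hp
  have heval : ∀ z : ℂ, p.eval z = (tensorPower t (H + z • K) * A) i j -
      (A * tensorPower t (H + z • K)) i j := fun z => by
    simp [hp, mul_apply, tensorPower, Polynomial.eval_finsetSum, Polynomial.eval_prod,
      mul_comm z]
  have hp0 : p = 0 := by
    refine Polynomial.eq_zero_of_infinite_isRoot p
      ((Set.infinite_range_of_injective Complex.ofReal_injective).mono ?_)
    rintro _ ⟨r, rfl⟩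
    have : p.eval (r : ℂ) = 0 := by rw [heval, hreal r, sub_self]
    exact this
  have := heval Complex.I
  rw [hp0, Polynomial.eval_zero, ← hg] at this
  exact (sub_eq_zero.1 this.symm)

/-- Two labelings with the same weights differ by a permutation of the factors. -/
theorem exists_perm_of_labelCount_eq {e k : Fin t → X} (he : Function.Injective e)
    (h : labelCount k = labelCount e) : ∃ σ : Equiv.Perm (Fin t), k = e ∘ σ := by
  have hex : ∀ s, ∃ s', k s' = e s := by
    intro s
    have h1 : 0 < labelCount k (e s) := by
      rw [h]
      exact Finset.card_pos.2 ⟨s, by simp⟩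
    obtain ⟨s', hs'⟩ := Finset.card_pos.1 h1
    exact ⟨s', (Finset.mem_filter.1 hs').2⟩
  choose τ hτ using hex
  have hinj : Function.Injective τ := fun a b hab => he (by rw [← hτ, ← hτ, hab])
  set ρ := Equiv.ofBijective τ (Finite.injective_iff_bijective.1 hinj)
  refine ⟨ρ.symm, ?_⟩
  rw [Equiv.eq_comp_symm]
  funext s
  exact hτ s

/-- The commutant of the tensor powers `U^{⊗ t}` of the unitaries is spanned by the permutation
operators, when the dimension is at least `t`. -/
theorem exists_eq_sum_permOperator (hX : t ≤ Fintype.card X)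
    (hA : ∀ U ∈ Matrix.unitaryGroup X ℂ, CommutesWithPower A U) :
    ∃ c : Equiv.Perm (Fin t) → ℂ, A = ∑ σ, c σ • permOperator X σ := by
  obtain ⟨e⟩ : Nonempty (Fin t ↪ X) :=
    Function.Embedding.nonempty_of_card_le (by simpa using hX)
  refine ⟨fun σ => A (e ∘ σ) e, ?_⟩
  ext i j
  -- `g` sends the basis vector `e s` to `j s`, so its power carries the labeling `e ∘ σ` to `j ∘
  -- σ`. Commuting with this power makes column `j` of `A` the image of column `e`, which is
  -- supported on the rearrangements of `e`.
  set g : Matrix X X ℂ := of fun x y => ∑ s, if y = e s ∧ x = j s then 1 else 0 with hg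
  have hge : ∀ x s, g x (e s) = if x = j s then 1 else 0 := by
    intro x s
    simp only [hg, of_apply, e.injective.eq_iff, ite_and]
    simp
  have hpow : ∀ (k : Fin t → X) (σ : Equiv.Perm (Fin t)),
      tensorPower t g k (e ∘ σ) = if k = j ∘ σ then 1 else 0 := by
    intro k σ
    simp only [tensorPower, of_apply, Function.comp_apply, hge, Finset.prod_ite_zero,
      Finset.prod_const_one, funext_iff, Finset.mem_univ, true_implies]
  have h := congrFun (congrFun (commutes_of_commutes_unitary hA g) i) e
  have hright : (A * tensorPower t g) i e = A i j := by
    rw [mul_apply, Finset.sum_eq_single j]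
    · have := hpow j 1
      simp only [Equiv.Perm.coe_one, Function.comp_id, if_true] at this
      rw [this, mul_one]
    · intro k _ hk
      have := hpow k 1
      simp only [Equiv.Perm.coe_one, Function.comp_id] at this
      simp [this, hk]
    · simp
  rw [hright, mul_apply] at h
  rw [← h, Matrix.sum_apply]
  symm
  refine Fintype.sum_of_injective (fun σ : Equiv.Perm (Fin t) => (e ∘ σ : Fin t → X)) ?_ _ _ ?_ ?_
  · intro σ τ hστ
    ext s
    have := e.injective (congrFun hστ s)
    rw [this]
  · intro k hk
    by_contra hne
    have hA0 : A k e ≠ 0 := fun h0 => hne (by rw [h0, mul_zero])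
    obtain ⟨σ, hσ⟩ := exists_perm_of_labelCount_eq e.injective (labelCount_eq_of_commutes hA hA0)
    exact hk ⟨σ, hσ.symm⟩
  · intro σ
    rw [hpow, Matrix.smul_apply, permOperator, of_apply, smul_eq_mul, mul_comm]

end TensorPowers

/-! ### The Haar projector -/

section Haar

open Matrix MeasureTheory

variable (X : Type) [Fintype X] [DecidableEq X] (t : ℕ)

instance haarUnitary_isProbabilityMeasure : IsProbabilityMeasure (haarUnitary X) :=
  ⟨Measure.haarMeasure_self (K₀ := (⊤ : TopologicalSpace.PositiveCompacts (unitaryGroup X ℂ)))⟩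

instance haarUnitary_isMulLeftInvariant : (haarUnitary X).IsMulLeftInvariant := by
  unfold haarUnitary; infer_instance

variable {X t}

theorem integrable_balancedPower (a b : (Fin t → X) × (Fin t → X)) :
    Integrable (fun C : unitaryGroup X ℂ => balancedPower t (C : Matrix X X ℂ) a b)
      (haarUnitary X) := by
  refine Continuous.integrable_of_hasCompactSupport ?_ (HasCompactSupport.of_compactSpace _)
  have h : ∀ i j, Continuous fun C : unitaryGroup X ℂ => (C : Matrix X X ℂ) i j := fun i j =>
    continuous_subtype_val.matrix_elem i j
  simp only [balancedPower, kroneckerMap_apply, tensorPower, of_apply, map_apply]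
  exact (continuous_finsetProd _ fun s _ => h _ _).mul
    (continuous_finsetProd _ fun s _ => (h _ _).star)

theorem quasiProjector_mul (B : Matrix ((Fin t → X) × (Fin t → X)) ((Fin t → X) × (Fin t → X)) ℂ)
    (a b : (Fin t → X) × (Fin t → X)) :
    (quasiProjector t (haarUnitary X) * B) a b =
      ∫ C, (balancedPower t (C : Matrix X X ℂ) * B) a b ∂haarUnitary X := by
  simp only [mul_apply, quasiProjector, of_apply]
  rw [integral_finsetSum _ fun c _ => (integrable_balancedPower a c).mul_const _]
  exact Finset.sum_congr rfl fun c _ => (integral_mul_const _ _).symm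

theorem balancedPower_mul_quasiProjector (U : unitaryGroup X ℂ) :
    balancedPower t (U : Matrix X X ℂ) * quasiProjector t (haarUnitary X) =
      quasiProjector t (haarUnitary X) := by
  ext a b
  simp only [mul_apply, quasiProjector, of_apply]
  rw [← integral_mul_left_eq_self (fun C : unitaryGroup X ℂ =>
    balancedPower t (C : Matrix X X ℂ) a b) U]
  simp only [Submonoid.coe_mul, balancedPower_mul, mul_apply]
  rw [integral_finsetSum _ fun c _ => (integrable_balancedPower c b).const_mul _]
  exact Finset.sum_congr rfl fun c _ => (integral_const_mul _ _).symm

/-- Left invariance alone suffices: each `C` in the average defining the adjoint is absorbed by the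
right factor. The left side is visibly Hermitian, so self-adjointness follows. -/
theorem conjTranspose_quasiProjector_mul_self :
    (quasiProjector t (haarUnitary X))ᴴ * quasiProjector t (haarUnitary X) =
      quasiProjector t (haarUnitary X) := by
  set G := quasiProjector t (haarUnitary X) with hG
  have h1 : ∀ C : unitaryGroup X ℂ, (balancedPower t (C : Matrix X X ℂ))ᴴ * G = G := fun C => by
    have h := balancedPower_mul_quasiProjector (t := t) (star C)
    rwa [Unitary.coe_star, star_eq_conjTranspose, balancedPower_conjTranspose] at h
  have hGa : ∀ a c, Gᴴ a c =
      ∫ C, (balancedPower t (C : Matrix X X ℂ))ᴴ a c ∂haarUnitary X := fun a c => by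
    simp only [conjTranspose_apply, hG, quasiProjector, of_apply, Complex.star_def]
    exact integral_conj.symm
  have hint : ∀ a c, Integrable (fun C : unitaryGroup X ℂ =>
      (balancedPower t (C : Matrix X X ℂ))ᴴ a c) (haarUnitary X) := fun a c => by
    simp only [conjTranspose_apply]
    exact (Complex.conjCLE : ℂ →L[ℝ] ℂ).integrable_comp (integrable_balancedPower c a)
  ext a b
  have h2 : (Gᴴ * G) a b =
      ∫ C, ((balancedPower t (C : Matrix X X ℂ))ᴴ * G) a b ∂haarUnitary X := by
    simp only [mul_apply, hGa]
    rw [integral_finsetSum _ fun c _ => (hint a c).mul_const _]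
    exact Finset.sum_congr rfl fun c _ => (integral_mul_const _ _).symm
  rw [h2]
  simp [h1]

theorem quasiProjector_conjTranspose :
    (quasiProjector t (haarUnitary X))ᴴ = quasiProjector t (haarUnitary X) := by
  conv_lhs => rw [← conjTranspose_quasiProjector_mul_self, conjTranspose_mul,
    conjTranspose_conjTranspose, conjTranspose_quasiProjector_mul_self]

/-- The vector of `t` copies and `t` conjugate copies that corresponds to a permutation. -/
def permVector (X : Type) [DecidableEq X] {t : ℕ} (σ : Equiv.Perm (Fin t)) :
    (Fin t → X) × (Fin t → X) → ℂ :=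
  fun a => if a.1 = a.2 ∘ σ then 1 else 0

theorem balancedPower_mulVec_permVector (U : unitaryGroup X ℂ) (σ : Equiv.Perm (Fin t)) :
    balancedPower t (U : Matrix X X ℂ) *ᵥ permVector X σ = permVector X σ := by
  have h := balancedPower_mulVec (U : Matrix X X ℂ) (permVector X σ)
  have h1 : (of fun i j => permVector X σ (i, j)) = permOperator X σ := rfl
  rw [h1, tensorPower_mul_permOperator, mul_assoc, ← tensorPower_conjTranspose,
    ← tensorPower_mul, ← star_eq_conjTranspose, mem_unitaryGroup_iff.1 U.2, tensorPower_one,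
    mul_one] at h
  funext a
  exact congrFun (congrFun h a.1) a.2

theorem quasiProjector_mulVec_permVector (σ : Equiv.Perm (Fin t)) :
    quasiProjector t (haarUnitary X) *ᵥ permVector X σ = permVector X σ := by
  funext a
  have h := quasiProjector_mul (X := X) (t := t) (of fun b _ => permVector X σ b) a a
  have h1 : ∀ C : unitaryGroup X ℂ,
      (balancedPower t (C : Matrix X X ℂ) * of fun b _ => permVector X σ b) a a =
        permVector X σ a := fun C =>
    congrFun (balancedPower_mulVec_permVector C σ) a
  simp only [h1, integral_const, probReal_univ, one_smul] at h
  exact h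

/-- When the dimension is at least `t`, the range of the Haar projector is spanned by the
permutation vectors. -/
theorem exists_quasiProjector_eq_sum (hX : t ≤ Fintype.card X) (b : (Fin t → X) × (Fin t → X)) :
    ∃ c : Equiv.Perm (Fin t) → ℂ, ∀ a, quasiProjector t (haarUnitary X) a b =
      ∑ σ, c σ * permVector X σ a := by
  set x : (Fin t → X) × (Fin t → X) → ℂ := fun a => quasiProjector t (haarUnitary X) a b with hx
  have hfix : ∀ U : unitaryGroup X ℂ, balancedPower t (U : Matrix X X ℂ) *ᵥ x = x := fun U =>
    funext fun a => congrFun (congrFun (balancedPower_mul_quasiProjector U) a) b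
  -- A column of the projector is fixed by every `U^{⊗ t,t}`. Read as a matrix, it is fixed by
  -- conjugation with `U^{⊗ t}`, so it lies in the commutant.
  obtain ⟨c, hc⟩ := exists_eq_sum_permOperator (A := of fun i j => x (i, j)) hX fun U hU => by
    have h := balancedPower_mulVec U x
    rw [hfix ⟨U, hU⟩] at h
    unfold CommutesWithPower
    conv_rhs => rw [h]
    rw [mul_assoc _ _ (tensorPower t U), ← tensorPower_conjTranspose, ← tensorPower_mul,
      ← star_eq_conjTranspose, mem_unitaryGroup_iff'.1 hU, tensorPower_one, mul_one]
  refine ⟨c, fun a => ?_⟩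
  have h := congrFun (congrFun hc a.1) a.2
  rw [Matrix.sum_apply] at h
  exact h

end Haar

/-! ### Haar projectors on the blocks of a partition -/

section Blocks

open Matrix

variable {d t : ℕ} {V : Type} [Fintype V] [DecidableEq V] {ι : Type} [Fintype ι] [DecidableEq ι]

/-- The unnormalized product state in which the copies at the site `v` are paired by `ρ v`. -/
def pairingVector (d : ℕ) {t : ℕ} {V : Type} [Fintype V] (ρ : V → Equiv.Perm (Fin t)) :
    MomentIndex d t V → ℂ :=
  fun a => if ∀ v s, a.1 s v = a.2 (ρ v s) v then 1 else 0

theorem permVector_eq_pairingVector (σ : Equiv.Perm (Fin t)) :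
    permVector (V → Fin d) σ = pairingVector d fun _ => σ := by
  funext a
  simp only [permVector, pairingVector]
  congr 1
  rw [eq_iff_iff, funext_iff, forall_comm]
  exact forall_congr' fun s => funext_iff

/-- A basis label of all the sites is a family of basis labels of the blocks. -/
def momentIndexEquivPi (d t : ℕ) (f : V → ι) :
    MomentIndex d t V ≃ ∀ k, MomentIndex d t {v // f v = k} where
  toFun a k := a.restrict fun v => f v = k
  invFun p := (fun s v => (p (f v)).1 s ⟨v, rfl⟩, fun s v => (p (f v)).2 s ⟨v, rfl⟩)
  left_inv a := rfl
  right_inv p := by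
    funext k
    refine Prod.ext ?_ ?_ <;>
    · funext s v
      obtain ⟨v, rfl⟩ := v
      rfl

theorem pairingVector_eq_prod (f : V → ι) (σ : ι → Equiv.Perm (Fin t)) (a : MomentIndex d t V) :
    pairingVector d (σ ∘ f) a =
      ∏ k, pairingVector d (fun _ => σ k) (a.restrict fun v => f v = k) := by
  simp only [pairingVector, Finset.prod_ite_zero, Finset.prod_const_one]
  congr 1
  simp only [MomentIndex.restrict, Subtype.forall, Finset.mem_univ, true_implies,
    Function.comp_apply, eq_iff_iff]
  constructor
  · rintro h k v rfl s
    exact h v s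
  · intro h v s
    exact h (f v) v rfl s

theorem haarProjector_conjTranspose : (haarProjector d t V)ᴴ = haarProjector d t V :=
  quasiProjector_conjTranspose

theorem haarProjector_mulVec_pairingVector (σ : Equiv.Perm (Fin t)) :
    haarProjector d t V *ᵥ pairingVector d (fun _ => σ) = pairingVector d fun _ => σ := by
  have h := quasiProjector_mulVec_permVector (X := V → Fin d) σ
  rwa [permVector_eq_pairingVector] at h

theorem exists_haarProjector_eq_sum (h : t ≤ d ^ Fintype.card V) (b : MomentIndex d t V) :
    ∃ c : Equiv.Perm (Fin t) → ℂ, ∀ a, haarProjector d t V a b =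
      ∑ σ, c σ * pairingVector d (fun _ => σ) a := by
  obtain ⟨c, hc⟩ := exists_quasiProjector_eq_sum (X := V → Fin d) (t := t) (by simpa using h) b
  refine ⟨c, fun a => ?_⟩
  simp only [← permVector_eq_pairingVector]
  exact hc a

theorem haarProjectorOnBlocks_conjTranspose (f : V → ι) :
    (haarProjectorOnBlocks d t f)ᴴ = haarProjectorOnBlocks d t f := by
  ext a b
  simp only [haarProjectorOnBlocks, conjTranspose_apply, of_apply, star_prod]
  exact Finset.prod_congr rfl fun k _ =>
    congrFun (congrFun (haarProjector_conjTranspose (V := {v // f v = k})) _) _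

theorem haarProjectorOnBlocks_mulVec_pairingVector (f : V → ι) (σ : ι → Equiv.Perm (Fin t)) :
    haarProjectorOnBlocks d t f *ᵥ pairingVector d (σ ∘ f) = pairingVector d (σ ∘ f) := by
  funext a
  simp only [mulVec, dotProduct, haarProjectorOnBlocks, of_apply, pairingVector_eq_prod,
    ← Finset.prod_mul_distrib]
  have h := Fintype.sum_equiv (momentIndexEquivPi d t f)
    (fun b => ∏ k, haarProjector d t {v // f v = k} (a.restrict fun v => f v = k)
      (b.restrict fun v => f v = k) *
        pairingVector d (fun _ => σ k) (b.restrict fun v => f v = k))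
    (fun p => ∏ k, haarProjector d t {v // f v = k} (a.restrict fun v => f v = k) (p k) *
        pairingVector d (fun _ => σ k) (p k)) fun b => rfl
  rw [h, ← Fintype.piFinset_univ, ← Finset.prod_univ_sum (fun k => Finset.univ)
    (fun k b => haarProjector d t {v // f v = k} (a.restrict fun v => f v = k) b *
        pairingVector d (fun _ => σ k) b)]
  exact Finset.prod_congr rfl fun k _ =>
    congrFun (haarProjector_mulVec_pairingVector (V := {v // f v = k}) (σ k)) _

theorem exists_haarProjectorOnBlocks_eq_sum (f : V → ι)
    (h : ∀ k, t ≤ d ^ Fintype.card {v // f v = k}) (b : MomentIndex d t V) :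
    ∃ c : (ι → Equiv.Perm (Fin t)) → ℂ, ∀ a, haarProjectorOnBlocks d t f a b =
      ∑ σ, c σ * pairingVector d (σ ∘ f) a := by
  choose c hc using fun k => exists_haarProjector_eq_sum (h k) (b.restrict fun v => f v = k)
  refine ⟨fun σ => ∏ k, c k (σ k), fun a => ?_⟩
  simp only [haarProjectorOnBlocks, of_apply, hc, pairingVector_eq_prod,
    ← Finset.prod_mul_distrib]
  rw [Finset.prod_univ_sum, Fintype.piFinset_univ]

/-- The range of a matrix whose columns are in the span of a finite family. -/
theorem exists_mulVec_eq_sum {Y S : Type*} [Fintype Y] [Fintype S] {A : Matrix Y Y ℂ}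
    {ψ : S → Y → ℂ} (h : ∀ b, ∃ c : S → ℂ, ∀ a, A a b = ∑ s, c s * ψ s a) (z : Y → ℂ) :
    ∃ c : S → ℂ, A *ᵥ z = ∑ s, c s • ψ s := by
  choose c hc using h
  refine ⟨fun s => ∑ b, z b * c b s, ?_⟩
  funext a
  simp only [mulVec, dotProduct, hc, Finset.sum_apply, Pi.smul_apply, smul_eq_mul,
    Finset.sum_mul]
  rw [Finset.sum_comm]
  exact Finset.sum_congr rfl fun s _ => Finset.sum_congr rfl fun b _ => by ring

/-! ### Overlaps -/

/-- Given the labels of the conjugate copies, `ρ` leaves a single choice for the other copies; what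
remains to be counted factorizes over the sites. -/
theorem sum_pairingVector_mul (ρ ρ' : V → Equiv.Perm (Fin t)) :
    ∑ a, pairingVector d ρ a * pairingVector d ρ' a =
      ∏ v, ((Finset.univ.filter fun u : Fin t → Fin d => u ∘ ρ v = u ∘ ρ' v).card : ℂ) := by
  have h1 : ∀ j : Fin t → V → Fin d, ∑ i : Fin t → V → Fin d,
      pairingVector d ρ (i, j) * pairingVector d ρ' (i, j) =
        ∏ v, if (fun s => j s v) ∘ ρ v = (fun s => j s v) ∘ ρ' v then 1 else 0 := by
    intro j
    rw [Finset.sum_eq_single fun s v => j (ρ v s) v]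
    · simp only [pairingVector, implies_true, if_true, one_mul, Finset.prod_ite_zero,
        Finset.prod_const_one, funext_iff, Finset.mem_univ, true_implies, Function.comp_apply]
    · intro i _ hi
      rw [pairingVector, if_neg, zero_mul]
      exact fun h => hi (funext fun s => funext fun v => h v s)
    · simp
  rw [Fintype.sum_prod_type_right]
  simp only [h1]
  have h2 := Fintype.sum_equiv (Equiv.piComm fun (_ : Fin t) (_ : V) => Fin d)
    (fun j => ∏ v, if (fun s => j s v) ∘ ρ v = (fun s => j s v) ∘ ρ' v then (1 : ℂ) else 0)
    (fun p => ∏ v, if p v ∘ ρ v = p v ∘ ρ' v then (1 : ℂ) else 0) fun j => rfl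
  rw [h2, ← Fintype.piFinset_univ, ← Finset.prod_univ_sum (fun v => Finset.univ)
    (fun v (u : Fin t → Fin d) => if u ∘ ρ v = u ∘ ρ' v then (1 : ℂ) else 0)]
  simp

/-- Distinct permutations agree on at most a `1 / d` fraction of the basis labels. -/
theorem card_comp_eq_mul_le {π π' : Equiv.Perm (Fin t)} (h : π ≠ π') :
    (Finset.univ.filter fun u : Fin t → Fin d => u ∘ π = u ∘ π').card * d ≤ d ^ t := by
  obtain ⟨s, hs⟩ : ∃ s, π s ≠ π' s := by
    by_contra! hc
    exact h (Equiv.ext hc)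
  have hcard : (((Finset.univ.filter fun u : Fin t → Fin d => u ∘ π = u ∘ π') ×ˢ
      (Finset.univ : Finset (Fin d))).card) ≤ (Finset.univ : Finset (Fin t → Fin d)).card := by
    -- Overwriting the entry at `π s` loses nothing: it equals the entry at `π' s`, a different
    -- position that is untouched.
    refine Finset.card_le_card_of_injOn (fun p => Function.update p.1 (π s) p.2)
      (fun _ _ => Finset.mem_coe.2 (Finset.mem_univ _)) ?_
    rintro ⟨u, x⟩ hu ⟨u', x'⟩ hu' heq
    simp only [Finset.coe_product, Set.mem_prod, Finset.mem_coe, Finset.mem_filter,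
      Finset.mem_univ, true_and, and_true] at hu hu'
    have hx : x = x' := by
      have := congrFun heq (π s)
      simpa using this
    have hne : ∀ r, r ≠ π s → u r = u' r := fun r hr => by
      have := congrFun heq r
      simpa [hr] using this
    have huu : u = u' := by
      funext r
      by_cases hr : r = π s
      · subst hr
        have e1 : u (π s) = u (π' s) := congrFun hu s
        have e2 : u' (π s) = u' (π' s) := congrFun hu' s
        rw [e1, e2]
        exact hne _ (Ne.symm hs)
      · exact hne r hr
    rw [hx, huu]
  simpa using hcard

/-- The normalized product state of the pairings `ρ`. -/
noncomputable def pairingState (d : ℕ) {t : ℕ} {V : Type} [Fintype V] (ρ : V → Equiv.Perm (Fin t)) :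
    EuclideanSpace ℂ (MomentIndex d t V) :=
  ((√((d : ℝ) ^ t) ^ Fintype.card V : ℝ) : ℂ)⁻¹ • WithLp.toLp 2 (pairingVector d ρ)

theorem inner_pairingState (ρ ρ' : V → Equiv.Perm (Fin t)) :
    inner ℂ (pairingState d ρ) (pairingState d ρ') =
      ((∏ v, ((Finset.univ.filter fun u : Fin t → Fin d => u ∘ ρ v = u ∘ ρ' v).card : ℝ) /
        (d : ℝ) ^ t : ℝ) : ℂ) := by
  have h : inner ℂ (WithLp.toLp 2 (pairingVector d ρ)) (WithLp.toLp 2 (pairingVector d ρ')) =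
      ∑ a, pairingVector d ρ a * pairingVector d ρ' a := by
    rw [EuclideanSpace.inner_toLp_toLp, dotProduct]
    refine Finset.sum_congr rfl fun a _ => ?_
    rw [mul_comm, Pi.star_apply]
    congr 1
    simp only [pairingVector]
    split_ifs <;> simp
  have hs : √((d : ℝ) ^ t) ^ Fintype.card V * √((d : ℝ) ^ t) ^ Fintype.card V =
      ((d : ℝ) ^ t) ^ Fintype.card V := by
    rw [← mul_pow, Real.mul_self_sqrt (by positivity)]
  rw [pairingState, pairingState, inner_smul_left, inner_smul_right, h, sum_pairingVector_mul,
    ← Complex.ofReal_inv, Complex.conj_ofReal, ← mul_assoc, ← Complex.ofReal_mul,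
    ← mul_inv, hs, Finset.prod_div_distrib, Finset.prod_const, Finset.card_univ]
  push_cast
  rw [div_eq_inv_mul]

theorem norm_pairingState (hd : 0 < d) (ρ : V → Equiv.Perm (Fin t)) :
    ‖pairingState d ρ‖ = 1 := by
  have h := inner_self_eq_norm_sq_to_K (𝕜 := ℂ) (pairingState d ρ)
  rw [inner_pairingState] at h
  have hd' : ((d : ℝ) ^ t) ≠ 0 := by positivity
  simp only [Finset.filter_true, Finset.card_univ, Fintype.card_fun, Fintype.card_fin,
    Nat.cast_pow, div_self hd', Finset.prod_const_one] at h
  have h2 : ‖pairingState d ρ‖ ^ 2 = 1 := (Complex.ofReal_injective (by simpa using h)).symm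
  nlinarith [norm_nonneg (pairingState d ρ)]

theorem norm_inner_pairingState_le (hd : 0 < d) (ρ ρ' : V → Equiv.Perm (Fin t)) :
    ‖inner ℂ (pairingState d ρ) (pairingState d ρ')‖ ≤
      ∏ v, if ρ v = ρ' v then 1 else (d : ℝ)⁻¹ := by
  have hd' : (0 : ℝ) < (d : ℝ) := by exact_mod_cast hd
  rw [inner_pairingState, Complex.norm_real, Real.norm_of_nonneg
    (Finset.prod_nonneg fun v _ => by positivity)]
  refine Finset.prod_le_prod (fun v _ => by positivity) fun v _ => ?_
  split_ifs with h
  · rw [h]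
    simp [div_self (pow_pos hd' t).ne']
  · rw [div_le_iff₀ (by positivity), inv_mul_eq_div, le_div_iff₀ hd']
    exact_mod_cast card_comp_eq_mul_le (d := d) h

end Blocks

/-! ### Products of projectors -/

section AbstractProjectors

variable {E : Type*} [NormedAddCommGroup E] [InnerProductSpace ℂ E]

theorem norm_apply_le_of_symmetric_idempotent {G : E →L[ℂ] E}
    (hsymm : ∀ x y, inner ℂ (G x) y = inner ℂ x (G y)) (hidem : ∀ x, G (G x) = G x) (x : E) :
    ‖G x‖ ≤ ‖x‖ := by
  have h : ‖G x‖ ^ 2 ≤ ‖x‖ * ‖G x‖ := by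
    have h1 : ((‖G x‖ ^ 2 : ℝ) : ℂ) = inner ℂ x (G x) := by
      rw [← hidem x, ← hsymm, hidem, inner_self_eq_norm_sq_to_K]
      simp
    have h2 := norm_inner_le_norm (𝕜 := ℂ) x (G x)
    rwa [← h1, Complex.norm_real, Real.norm_of_nonneg (by positivity)] at h2
  by_contra! hc
  nlinarith [norm_nonneg x]

variable {S R : Type*} [Fintype S] [Fintype R]

theorem apply_eq_self_of_eq_sum {G : E →L[ℂ] E} {ψ : S → E} (hψ : ∀ s, G (ψ s) = ψ s) {x : E}
    (hx : ∃ c : S → ℂ, x = ∑ s, c s • ψ s) : G x = x := by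
  obtain ⟨c, rfl⟩ := hx
  simp [map_sum, hψ]

/-- Let `P`, `Q` and `H` be orthogonal projections onto the spans of `φ`, `ψ` and of a family `χ`
that is contained in both. If the overlaps of the `φ τ` outside `χ` with the `ψ σ` are small, then
`P * Q` is close to `H`. -/
theorem norm_mul_sub_le_of_overlaps {L : Type*} [Fintype L] {P Q H : E →L[ℂ] E} {φ : R → E}
    {ψ : S → E} {χ : L → E}
    (hP : ∀ x y, inner ℂ (P x) y = inner ℂ x (P y)) (hQ : ∀ x y, inner ℂ (Q x) y = inner ℂ x (Q y))
    (hH : ∀ x y, inner ℂ (H x) y = inner ℂ x (H y))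
    (hPφ : ∀ τ, P (φ τ) = φ τ) (hQψ : ∀ σ, Q (ψ σ) = ψ σ) (hHχ : ∀ l, H (χ l) = χ l)
    (hPχ : ∀ l, P (χ l) = χ l) (hQχ : ∀ l, Q (χ l) = χ l)
    (hPr : ∀ z, ∃ c : R → ℂ, P z = ∑ τ, c τ • φ τ) (hQr : ∀ z, ∃ c : S → ℂ, Q z = ∑ σ, c σ • ψ σ)
    (hHr : ∀ z, ∃ c : L → ℂ, H z = ∑ l, c l • χ l)
    (N : Finset R) (hN : ∀ τ ∉ N, ∃ l, φ τ = χ l)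
    (hφ : ∀ c : R → ℂ, ∑ τ, ‖c τ‖ ^ 2 ≤ 2 * ‖∑ τ, c τ • φ τ‖ ^ 2)
    (hψ : ∀ c : S → ℂ, ∑ σ, ‖c σ‖ ^ 2 ≤ 2 * ‖∑ σ, c σ • ψ σ‖ ^ 2) {F : ℝ}
    (hF : ∑ τ ∈ N, ∑ σ, ‖inner ℂ (φ τ) (ψ σ)‖ ^ 2 ≤ F) :
    ‖P * Q - H‖ ≤ 4 * √F := by
  have hPP : ∀ x, P (P x) = P x := fun x => apply_eq_self_of_eq_sum hPφ (hPr x)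
  have hQQ : ∀ x, Q (Q x) = Q x := fun x => apply_eq_self_of_eq_sum hQψ (hQr x)
  have hHH : ∀ x, H (H x) = H x := fun x => apply_eq_self_of_eq_sum hHχ (hHr x)
  have hPH : ∀ x, P (H x) = H x := fun x => apply_eq_self_of_eq_sum hPχ (hHr x)
  have hQH : ∀ x, Q (H x) = H x := fun x => apply_eq_self_of_eq_sum hQχ (hHr x)
  refine ContinuousLinearMap.opNorm_le_bound _ (by positivity) fun z => ?_
  set w := (P * Q - H) z with hw
  have hw' : w = P (Q z) - H z := rfl
  obtain ⟨x, hx⟩ := hPr w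
  obtain ⟨y, hy⟩ := hQr (z - H z)
  have hyz : Q (z - H z) = Q z - H z := by rw [map_sub, hQH]
  -- Both `Q` and `H` fix the states `χ l`, so `Q z` and `H z` have the same inner product with
  -- them.
  have horth : ∀ τ ∉ N, inner ℂ (φ τ) (∑ σ, y σ • ψ σ) = 0 := by
    intro τ hτ
    obtain ⟨l, hl⟩ := hN τ hτ
    rw [← hy, hyz, hl, inner_sub_right, ← hQ, ← hH, hQχ, hHχ, sub_self]
  have hmain := norm_inner_le_of_overlaps ψ φ x y N horth hF (hφ x) (hψ y)
  rw [← hx, ← hy, hyz, hP, map_sub, hPH, ← hw', inner_self_eq_norm_sq_to_K] at hmain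
  have hmain' : ‖w‖ ^ 2 ≤ 2 * √F * ‖P w‖ * ‖Q z - H z‖ := by simpa using hmain
  have h1 : ‖P w‖ ≤ ‖w‖ := norm_apply_le_of_symmetric_idempotent hP hPP w
  have h2 : ‖Q z - H z‖ ≤ 2 * ‖z‖ := by
    refine (norm_sub_le _ _).trans ?_
    have := norm_apply_le_of_symmetric_idempotent hQ hQQ z
    have := norm_apply_le_of_symmetric_idempotent hH hHH z
    linarith
  have h3 : ‖w‖ ^ 2 ≤ (4 * √F * ‖z‖) * ‖w‖ := by
    calc ‖w‖ ^ 2 ≤ 2 * √F * ‖P w‖ * ‖Q z - H z‖ := hmain'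
      _ ≤ 2 * √F * ‖w‖ * (2 * ‖z‖) := by gcongr
      _ = _ := by ring
  by_contra! hc
  have hwpos : 0 < ‖w‖ := lt_of_le_of_lt (by positivity) hc
  nlinarith

end AbstractProjectors

/-! ### Application to Haar projectors on transversal partitions -/

section BlockProjectors

open Matrix

theorem inner_toEuclideanCLM_left {Y : Type*} [Fintype Y] [DecidableEq Y] {A : Matrix Y Y ℂ}
    (hA : Aᴴ = A) (x y : EuclideanSpace ℂ Y) :
    inner ℂ (toEuclideanCLM (n := Y) (𝕜 := ℂ) A x) y =
      inner ℂ x (toEuclideanCLM (n := Y) (𝕜 := ℂ) A y) := by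
  conv_lhs => rw [← hA, ← star_eq_conjTranspose, map_star, ContinuousLinearMap.star_eq_adjoint,
    ContinuousLinearMap.adjoint_inner_left]

variable {d t : ℕ} {V : Type} [Fintype V] [DecidableEq V] {ι κ : Type} [Fintype ι] [DecidableEq ι]
  [Fintype κ] [DecidableEq κ]

theorem toLp_pairingVector (hd : 0 < d) (ρ : V → Equiv.Perm (Fin t)) :
    WithLp.toLp 2 (pairingVector d ρ) =
      ((√((d : ℝ) ^ t) ^ Fintype.card V : ℝ) : ℂ) • pairingState d ρ := by
  rw [pairingState, smul_inv_smul₀]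
  rw [Ne, Complex.ofReal_eq_zero]
  positivity

theorem toEuclideanCLM_pairingState {A : Matrix (MomentIndex d t V) (MomentIndex d t V) ℂ}
    {ρ : V → Equiv.Perm (Fin t)} (h : A *ᵥ pairingVector d ρ = pairingVector d ρ) :
    toEuclideanCLM (n := MomentIndex d t V) (𝕜 := ℂ) A (pairingState d ρ) = pairingState d ρ := by
  rw [pairingState, map_smul, toEuclideanCLM_toLp, h]

theorem exists_toEuclideanCLM_eq_sum (hd : 0 < d) {S : Type*} [Fintype S]
    {A : Matrix (MomentIndex d t V) (MomentIndex d t V) ℂ} {ρ : S → V → Equiv.Perm (Fin t)}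
    (h : ∀ b, ∃ c : S → ℂ, ∀ a, A a b = ∑ s, c s * pairingVector d (ρ s) a)
    (z : EuclideanSpace ℂ (MomentIndex d t V)) :
    ∃ c : S → ℂ, toEuclideanCLM (n := MomentIndex d t V) (𝕜 := ℂ) A z =
      ∑ s, c s • pairingState d (ρ s) := by
  obtain ⟨c, hc⟩ := exists_mulVec_eq_sum h z.ofLp
  refine ⟨fun s => c s * ((√((d : ℝ) ^ t) ^ Fintype.card V : ℝ) : ℂ), ?_⟩
  have hz : z = WithLp.toLp 2 z.ofLp := rfl
  rw [hz, toEuclideanCLM_toLp, hc, WithLp.toLp_sum]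
  exact Finset.sum_congr rfl fun s _ => by
    rw [WithLp.toLp_smul, toLp_pairingVector hd, smul_smul]

theorem prod_comp_eq_prod_pow {f : V → ι} {m : ℕ}
    (hf : ∀ i, Fintype.card {v // f v = i} = m) (h : ι → ℝ) :
    ∏ v, h (f v) = ∏ i, h i ^ m := by
  rw [← Finset.prod_fiberwise_of_maps_to (g := f) (t := Finset.univ) fun _ _ => Finset.mem_univ _]
  refine Finset.prod_congr rfl fun i _ => ?_
  rw [← hf i, Fintype.card_subtype, ← Finset.prod_const]
  exact Finset.prod_congr rfl fun v hv => by rw [(Finset.mem_filter.1 hv).2]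

/-- Product states over the blocks of a partition are almost orthonormal. -/
theorem sum_norm_sq_le_pairingState (hd : 0 < d) {f : V → ι} {m : ℕ}
    (hf : ∀ i, Fintype.card {v // f v = i} = m)
    (hm : (1 + (t.factorial : ℝ) * ((d : ℝ)⁻¹) ^ m) ^ Fintype.card ι ≤ 3 / 2)
    (c : (ι → Equiv.Perm (Fin t)) → ℂ) :
    ∑ σ, ‖c σ‖ ^ 2 ≤ 2 * ‖∑ σ, c σ • pairingState d (σ ∘ f)‖ ^ 2 := by
  refine sum_norm_sq_le_of_gram _ (fun σ => norm_pairingState hd _) (fun σ => ?_) c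
  have h := sum_ne_prod_ite_le (P := Equiv.Perm (Fin t)) σ (r := ((d : ℝ)⁻¹) ^ m) (by positivity)
  rw [Fintype.card_perm, Fintype.card_fin] at h
  refine le_trans (Finset.sum_le_sum fun σ' _ => ?_) (h.trans (by linarith))
  refine (norm_inner_pairingState_le hd _ _).trans (le_of_eq ?_)
  have h2 := prod_comp_eq_prod_pow hf fun i => if σ i = σ' i then 1 else (d : ℝ)⁻¹
  simp only [ite_pow, one_pow] at h2
  exact h2

/-- By transversality a block of `f` meets each block of `g` exactly once, so `g` identifies it with
`κ`. -/
theorem card_fiber_fst {f : V → ι} {g : V → κ} (h : Function.Bijective fun v => (f v, g v))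
    (i : ι) : Fintype.card {v // f v = i} = Fintype.card κ := by
  refine Fintype.card_of_bijective (f := fun v : {v // f v = i} => g v) ⟨?_, fun k => ?_⟩
  · rintro ⟨v, hv⟩ ⟨w, hw⟩ hvw
    exact Subtype.ext (h.1 (Prod.ext (hv.trans hw.symm) hvw))
  · obtain ⟨v, hv⟩ := h.2 (i, k)
    exact ⟨⟨v, congrArg Prod.fst hv⟩, congrArg Prod.snd hv⟩

theorem card_fiber_snd {f : V → ι} {g : V → κ} (h : Function.Bijective fun v => (f v, g v))
    (k : κ) : Fintype.card {v // g v = k} = Fintype.card ι :=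
  card_fiber_fst (f := g) (g := f) ((Equiv.prodComm ι κ).bijective.comp h) k

/-- Haar projectors on the blocks of two transversal partitions: their product is close to the
global Haar projector. -/
theorem schattenInfNorm_blocks_le (hd : 0 < d) (f : V → ι) (g : V → κ)
    (h : Function.Bijective fun v => (f v, g v))
    (ht1 : t ≤ d ^ Fintype.card κ) (ht2 : t ≤ d ^ Fintype.card ι) (ht3 : t ≤ d ^ Fintype.card V)
    (hm1 : (1 + (t.factorial : ℝ) * ((d : ℝ)⁻¹) ^ Fintype.card κ) ^ Fintype.card ι ≤ 3 / 2)
    (hm2 : (1 + (t.factorial : ℝ) * ((d : ℝ)⁻¹) ^ Fintype.card ι) ^ Fintype.card κ ≤ 3 / 2)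
    {F : ℝ}
    (hF : 2 ^ Fintype.card ι * (t.factorial * ((1 + t.factorial * (((d : ℝ)⁻¹) ^ 2) ^
        Fintype.card ι) ^ Fintype.card κ - 1)) + t.factorial ^ Fintype.card κ *
        (2 ^ Fintype.card ι * (t.factorial * ((d : ℝ)⁻¹) ^ Fintype.card κ) ^ Fintype.card ι) ≤
        F) :
    schattenInfNorm (haarProjectorOnBlocks d t g * haarProjectorOnBlocks d t f -
      haarProjector d t V) ≤ 4 * √F := by
  have hd1 : (d : ℝ)⁻¹ ≤ 1 := inv_le_one_of_one_le₀ (by exact_mod_cast hd)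
  have hblk : ∀ σ : Equiv.Perm (Fin t), ∀ {ι' : Type} [Fintype ι'] [DecidableEq ι'] (f' : V → ι'),
      haarProjectorOnBlocks d t f' *ᵥ pairingVector d (fun _ => σ) = pairingVector d fun _ => σ :=
    fun σ ι' _ _ f' => haarProjectorOnBlocks_mulVec_pairingVector f' fun _ => σ
  rw [schattenInfNorm, map_sub, map_mul]
  classical
  refine norm_mul_sub_le_of_overlaps
    (φ := fun τ : κ → Equiv.Perm (Fin t) => pairingState d (τ ∘ g))
    (ψ := fun σ : ι → Equiv.Perm (Fin t) => pairingState d (σ ∘ f))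
    (χ := fun σ : Equiv.Perm (Fin t) => pairingState d fun _ => σ)
    (inner_toEuclideanCLM_left (haarProjectorOnBlocks_conjTranspose g))
    (inner_toEuclideanCLM_left (haarProjectorOnBlocks_conjTranspose f))
    (inner_toEuclideanCLM_left haarProjector_conjTranspose)
    (fun τ => toEuclideanCLM_pairingState (haarProjectorOnBlocks_mulVec_pairingVector g τ))
    (fun σ => toEuclideanCLM_pairingState (haarProjectorOnBlocks_mulVec_pairingVector f σ))
    (fun σ => toEuclideanCLM_pairingState (haarProjector_mulVec_pairingVector σ))
    (fun σ => toEuclideanCLM_pairingState (hblk σ g))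
    (fun σ => toEuclideanCLM_pairingState (hblk σ f))
    (exists_toEuclideanCLM_eq_sum hd (exists_haarProjectorOnBlocks_eq_sum g fun k => by
      rwa [card_fiber_snd h]))
    (exists_toEuclideanCLM_eq_sum hd (exists_haarProjectorOnBlocks_eq_sum f fun k => by
      rwa [card_fiber_fst h]))
    (exists_toEuclideanCLM_eq_sum hd (exists_haarProjector_eq_sum ht3))
    (Finset.univ.filter fun τ => ∀ π, τ ≠ Function.const κ π) ?_
    (sum_norm_sq_le_pairingState hd (card_fiber_snd h) hm2)
    (sum_norm_sq_le_pairingState hd (card_fiber_fst h) hm1) ?_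
  · intro τ hτ
    simp only [ne_eq, Finset.mem_filter, Finset.mem_univ, true_and, not_forall, not_not] at hτ
    obtain ⟨π, rfl⟩ := hτ
    exact ⟨π, rfl⟩
  · refine le_trans (Finset.sum_le_sum fun τ _ => Finset.sum_le_sum fun σ _ => ?_)
      ((sum_nonconst_prod_ite_le (ι := ι) (inv_nonneg.2 (Nat.cast_nonneg d)) hd1 _
        (fun τ hτ => (Finset.mem_filter.1 hτ).2)).trans ?_)
    · refine (pow_le_pow_left₀ (norm_nonneg _) (norm_inner_pairingState_le hd _ _) 2).trans
        (le_of_eq ?_)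
      -- Sites are pairs `(i, k)`, and the site `(i, k)` compares `σ i` with `τ k`.
      have h1 := Fintype.prod_equiv (Equiv.ofBijective _ h)
        (fun v => if τ (g v) = σ (f v) then 1 else ((d : ℝ)⁻¹) ^ 2)
        (fun p => if τ p.2 = σ p.1 then 1 else ((d : ℝ)⁻¹) ^ 2) fun v => rfl
      rw [Fintype.prod_prod_type] at h1
      rw [← h1, ← Finset.prod_pow]
      simp only [ite_pow, one_pow, Function.comp_apply]
    · simpa only [Fintype.card_perm, Fintype.card_fin] using hF

/-- When one partition has a single block, the product is exactly the global Haar projector. -/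
theorem haarProjectorOnBlocks_mul_eq_haarProjector [Unique ι] (f : V → ι) (g : V → κ)
    (ht : t ≤ d ^ Fintype.card V) :
    haarProjectorOnBlocks d t g * haarProjectorOnBlocks d t f = haarProjector d t V := by
  set H := haarProjector d t V with hH
  have hfix : ∀ {A B : Matrix (MomentIndex d t V) (MomentIndex d t V) ℂ},
      (∀ σ, A *ᵥ pairingVector d (fun _ => σ) = pairingVector d fun _ => σ) →
      (∀ b, ∃ c : Equiv.Perm (Fin t) → ℂ, ∀ a, B a b =
        ∑ σ, c σ * pairingVector d (fun _ => σ) a) → A * B = B := by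
    intro A B hA hB
    ext a b
    obtain ⟨c, hc⟩ := hB b
    have h1 : (fun a => B a b) = ∑ σ, c σ • pairingVector d (fun _ => σ) := by
      funext a
      simp [hc]
    have h2 : A *ᵥ (fun a => B a b) = fun a => B a b := by
      rw [h1, mulVec_sum]
      simp only [mulVec_smul, hA]
    exact congrFun h2 a
  have hHr := exists_haarProjector_eq_sum (V := V) ht
  have hGr : ∀ b, ∃ c : Equiv.Perm (Fin t) → ℂ, ∀ a, haarProjectorOnBlocks d t f a b =
      ∑ σ, c σ * pairingVector d (fun _ => σ) a := by
    intro b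
    obtain ⟨c, hc⟩ := exists_haarProjectorOnBlocks_eq_sum f (fun k => by
      rwa [Fintype.card_subtype, Finset.filter_true_of_mem fun v _ => Subsingleton.elim _ _,
        Finset.card_univ]) b
    refine ⟨fun σ => c fun _ => σ, fun a => ?_⟩
    rw [hc]
    refine Fintype.sum_equiv (Equiv.funUnique ι _) _ _ fun σ => ?_
    have hσ : σ = fun _ => σ default := funext fun i => by rw [Unique.eq_default i]
    have hσf : σ ∘ f = fun _ => σ default := funext fun v => by
      rw [Function.comp_apply, Unique.eq_default (f v)]
    rw [hσf]
    exact congrArg (c · * _) hσ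
  have h1 : H * haarProjectorOnBlocks d t f = haarProjectorOnBlocks d t f :=
    hfix haarProjector_mulVec_pairingVector hGr
  have h2 : haarProjectorOnBlocks d t f * H = H :=
    hfix (fun σ => haarProjectorOnBlocks_mulVec_pairingVector f fun _ => σ) hHr
  -- The two projectors fix each other's columns; the adjoint of one relation, compared with the
  -- other, gives equality.
  have h3 : haarProjectorOnBlocks d t f = H := by
    have := congrArg conjTranspose h1
    rw [conjTranspose_mul, haarProjectorOnBlocks_conjTranspose, hH,
      haarProjector_conjTranspose, ← hH, h2] at this
    exact this.symm
  rw [h3]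
  exact hfix (fun σ => haarProjectorOnBlocks_mulVec_pairingVector g fun _ => σ) hHr

end BlockProjectors

/-! ### Numerical bounds -/

section Numerics

/-- With `y = n x`, `exp y ≤ 1 / (1 - y) ≤ 1 + 3 y / 2`, the last step holding exactly because `y ≤
1/3`. At that threshold the bound is 1/2, as the Gram estimate requires. -/
theorem one_add_pow_sub_one_le {x : ℝ} (hx : 0 ≤ x) (n : ℕ) (h : n * x ≤ 1 / 3) :
    (1 + x) ^ n - 1 ≤ 3 / 2 * (n * x) := by
  have h0 : 0 ≤ n * x := by positivity
  have h1 : (1 + x) ^ n ≤ Real.exp (n * x) := by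
    rw [Real.exp_nat_mul]
    exact pow_le_pow_left₀ (by linarith) (by linarith [Real.add_one_le_exp x]) n
  have h2 := Real.exp_bound_div_one_sub_of_interval h0 (by linarith)
  have h3 : 1 / (1 - n * x) ≤ 1 + 3 / 2 * (n * x) := by
    rw [div_le_iff₀ (by linarith)]
    nlinarith
  linarith

/-- The numerical content of `schattenInfNorm_blocks_le`. -/
theorem overlap_sum_le {q T : ℝ} {m M : ℕ} (hq0 : 0 < q) (hq : q ≤ 1 / 2) (hT : 1 ≤ T)
    (hm : 1 ≤ m) (hmM : m ≤ M) (h1 : 3 * M * T ≤ 2 ^ m) (h2 : 4 * T ^ 2 ≤ 2 ^ m) :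
    2 ^ M * (T * ((1 + T * (q ^ 2) ^ M) ^ m - 1)) + T ^ m * (2 ^ M * (T * q ^ m) ^ M) ≤
      3 * T ^ 2 * M * q ^ M := by
  have hmM' : (m : ℝ) ≤ M := by exact_mod_cast hmM
  have hM1 : (1 : ℝ) ≤ M := by exact_mod_cast hm.trans hmM
  have h2q : 2 ^ M * q ^ M ≤ 1 := by
    rw [← mul_pow]; exact pow_le_one₀ (by positivity) (by linarith)
  have h2qm : 2 ^ m * q ^ m ≤ 1 := by
    rw [← mul_pow]; exact pow_le_one₀ (by positivity) (by linarith)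
  have hqm : q ^ M ≤ q ^ m := pow_le_pow_of_le_one hq0.le (by linarith) hmM
  have hqM1 : q ^ M ≤ 1 := pow_le_one₀ hq0.le (by linarith)
  have hA : (q ^ 2) ^ M = q ^ M * q ^ M := by rw [← pow_mul, ← pow_add]; congr 1; ring
  have hx : m * (T * (q ^ 2) ^ M) ≤ 1 / 3 := by
    have : m * (T * (q ^ 2) ^ M) ≤ M * (T * (q ^ m * 1)) := by
      rw [hA]; gcongr
    have h5 : 3 * M * T * q ^ m ≤ 2 ^ m * q ^ m := by gcongr
    nlinarith
  have hB := one_add_pow_sub_one_le (x := T * (q ^ 2) ^ M) (by positivity) m hx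
  have hfirst : 2 ^ M * (T * ((1 + T * (q ^ 2) ^ M) ^ m - 1)) ≤ 3 / 2 * T ^ 2 * M * q ^ M := by
    calc 2 ^ M * (T * ((1 + T * (q ^ 2) ^ M) ^ m - 1))
        ≤ 2 ^ M * (T * (3 / 2 * (m * (T * (q ^ 2) ^ M)))) := by gcongr
      -- One of the two factors `q ^ M` pays for `2 ^ M`; the other is the decay that survives.
      _ = (2 ^ M * q ^ M) * (3 / 2 * T ^ 2 * m * q ^ M) := by rw [hA]; ring
      _ ≤ 1 * (3 / 2 * T ^ 2 * M * q ^ M) := by gcongr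
      _ = _ := one_mul _
  -- One `q` is split off from `q ^ m`; the remaining `q ^ (m - 1)` absorbs `2 T²`, because `4 T² ≤
  -- 2 ^ m`.
  have hsecond : T ^ m * (2 ^ M * (T * q ^ m) ^ M) ≤ q ^ M := by
    have hm' : q ^ m = q * q ^ (m - 1) := by rw [← pow_succ']; congr 1; omega
    have h6 : 2 * T ^ 2 * q ^ (m - 1) ≤ 1 := by
      have h7 : (2 : ℝ) ^ m = 2 * 2 ^ (m - 1) := by rw [← pow_succ']; congr 1; omega
      have h8 : 2 ^ (m - 1) * q ^ (m - 1) ≤ 1 := by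
        rw [← mul_pow]; exact pow_le_one₀ (by positivity) (by linarith)
      have h9 : 2 * T ^ 2 ≤ 2 ^ (m - 1) := by linarith
      exact (mul_le_mul_of_nonneg_right h9 (by positivity)).trans h8
    calc T ^ m * (2 ^ M * (T * q ^ m) ^ M) ≤ T ^ M * (2 ^ M * (T * q ^ m) ^ M) := by
          gcongr
      _ = (q * (2 * T ^ 2 * q ^ (m - 1))) ^ M := by
          rw [← mul_pow, ← mul_pow, hm']; congr 1; ring
      _ ≤ (q * 1) ^ M := by gcongr
      _ = q ^ M := by rw [mul_one]
  have h10 : q ^ M ≤ 3 / 2 * T ^ 2 * M * q ^ M := by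
    have : 1 ≤ T ^ 2 * M := by nlinarith
    have h11 : 0 < q ^ M := by positivity
    nlinarith
  linarith

/-- The square root leaves `d^(-M/2)`, and half of that exponent is spent on the prefactor, whence
1/4. Squaring the goal turns `4` and `3` into `48`, and 2304 is `48²`. -/
theorem four_mul_sqrt_le {T : ℝ} {d M : ℕ} (hd : 2 ≤ d)
    (h : 2304 * M ^ 2 * T ^ 4 ≤ 2 ^ M) :
    4 * √(3 * T ^ 2 * M * ((d : ℝ)⁻¹) ^ M) ≤ 1 / (d : ℝ) ^ (1 / 4 * (M : ℝ)) := by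
  have hd' : (2 : ℝ) ≤ d := by exact_mod_cast hd
  have hd0 : (0 : ℝ) < d := by linarith
  set r : ℝ := (d : ℝ) ^ (1 / 4 * (M : ℝ)) with hr
  have hr0 : 0 < r := Real.rpow_pos_of_pos hd0 _
  have hr4 : r ^ 4 = (d : ℝ) ^ M := by
    rw [hr, ← Real.rpow_natCast, ← Real.rpow_mul hd0.le, ← Real.rpow_natCast]
    congr 1; push_cast; ring
  have hle : 48 * T ^ 2 * M ≤ r ^ 2 := by
    refine le_of_sq_le_sq ?_ (by positivity)
    calc (48 * T ^ 2 * M) ^ 2 = 2304 * M ^ 2 * T ^ 4 := by ring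
      _ ≤ 2 ^ M := h
      _ ≤ (d : ℝ) ^ M := by gcongr
      _ = (r ^ 2) ^ 2 := by rw [← hr4]; ring
  have hsq : 3 * T ^ 2 * M * ((d : ℝ)⁻¹) ^ M ≤ (1 / (4 * r)) ^ 2 := by
    rw [inv_pow, ← hr4, ← div_eq_mul_inv, div_pow, div_le_div_iff₀ (by positivity) (by positivity)]
    nlinarith [pow_pos hr0 2]
  calc 4 * √(3 * T ^ 2 * M * ((d : ℝ)⁻¹) ^ M) ≤ 4 * (1 / (4 * r)) := by
        gcongr
        exact Real.sqrt_le_iff.2 ⟨by positivity, hsq⟩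
    _ = 1 / r := by field_simp

/-- The first two inequalities compare `M` and `T` with `2 ^ m`, so `M` may grow with `m`, but
subexponentially: `exp √m` is far below `2 ^ m`. The third involves only `M` and `T`. -/
theorem exists_threshold {T : ℝ} (hT : 1 ≤ T) : ∃ m₀ : ℕ, 1 ≤ m₀ ∧ ∀ m ≥ m₀, ∀ M : ℕ, m ≤ M →
    (M : ℝ) ≤ Real.exp √m → 3 * M * T ≤ 2 ^ m ∧ 4 * T ^ 2 ≤ 2 ^ m ∧
      2304 * (M : ℝ) ^ 2 * T ^ 4 ≤ 2 ^ M := by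
  have hlim := tendsto_pow_const_div_const_pow_of_one_lt 2 (r := (2 : ℝ)) (by norm_num)
  have hev := hlim.eventually_le_const (u := 1 / (2304 * T ^ 4)) (by positivity)
  obtain ⟨M₀, hM₀⟩ := Filter.eventually_atTop.1 hev
  obtain ⟨A, hA⟩ := exists_nat_ge (4 * Real.log (4 * T ^ 2))
  -- 16 ensures `√m ≤ m / 4`, `M₀` yields the third inequality, and `A` ensures `4 T² ≤ exp (m /
  -- 4)`.
  refine ⟨max (max 16 M₀) A, le_trans (by norm_num) ((le_max_left 16 M₀).trans (le_max_left _ _)),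
    fun m hm M hmM hM => ?_⟩
  simp only [ge_iff_le, max_le_iff] at hm
  obtain ⟨⟨hm16, hmM₀⟩, hmA⟩ := hm
  have hm16' : (16 : ℝ) ≤ m := by exact_mod_cast hm16
  have hlog : Real.log (4 * T ^ 2) ≤ m / 4 := by
    have : (A : ℝ) ≤ m := by exact_mod_cast hmA
    linarith
  have hexp : Real.exp (m / 2) ≤ 2 ^ m := by
    have h2 : Real.exp (1 / 2) ≤ 2 := by
      have := Real.exp_bound_div_one_sub_of_interval (x := 1 / 2) (by norm_num) (by norm_num)
      norm_num at this ⊢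
      exact this
    calc Real.exp (m / 2) = Real.exp (1 / 2) ^ m := by rw [← Real.exp_nat_mul]; congr 1; ring
      _ ≤ 2 ^ m := by gcongr
  have hT4 : 4 * T ^ 2 ≤ Real.exp (m / 4) := by
    rw [← Real.log_le_iff_le_exp (by positivity)]; exact hlog
  have hsqrt : √(m : ℝ) ≤ m / 4 := by
    rw [Real.sqrt_le_iff]
    exact ⟨by positivity, by nlinarith⟩
  refine ⟨?_, ?_, ?_⟩
  · calc 3 * M * T ≤ 3 * Real.exp √m * T := by gcongr
      _ ≤ Real.exp (m / 4) * (4 * T ^ 2) := by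
          have := Real.exp_le_exp.2 hsqrt
          have h3 : 3 * T ≤ 4 * T ^ 2 := by nlinarith
          calc 3 * Real.exp √m * T = Real.exp √m * (3 * T) := by ring
            _ ≤ _ := by gcongr
      _ ≤ Real.exp (m / 4) * Real.exp (m / 4) := by gcongr
      _ = Real.exp (m / 2) := by rw [← Real.exp_add]; congr 1; ring
      _ ≤ 2 ^ m := hexp
  · refine hT4.trans (le_trans (Real.exp_le_exp.2 ?_) hexp)
    linarith
  · have := hM₀ M (hmM₀.trans hmM)
    rw [div_le_div_iff₀ (by positivity) (by positivity)] at this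
    linarith

/-- This is the growth condition of `exists_threshold` in the square case `M = m`. -/
theorem le_exp_sqrt (m : ℕ) : (m : ℝ) ≤ Real.exp √m := by
  set x := √(m : ℝ) with hx
  have hx0 : 0 ≤ x := Real.sqrt_nonneg _
  have hm : (m : ℝ) = x ^ 2 := (Real.sq_sqrt (Nat.cast_nonneg m)).symm
  have h1 := Real.quadratic_le_exp_of_nonneg (x := x / 2) (by positivity)
  have h2 : Real.exp x = Real.exp (x / 2) ^ 2 := by
    rw [← Real.exp_nat_mul]; congr 1; push_cast; ring
  rw [hm, h2]
  exact pow_le_pow_left₀ hx0 (by nlinarith [sq_nonneg (x - 2)]) 2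

end Numerics

/-! ### Rows, columns and planes of the lattice -/

section Lattices

theorem le_pow_of_four_mul_sq_le {t d m : ℕ} (hd : 2 ≤ d)
    (h : 4 * (t.factorial : ℝ) ^ 2 ≤ 2 ^ m) : t ≤ d ^ m := by
  have h1 : 4 * t.factorial ^ 2 ≤ 2 ^ m := by exact_mod_cast h
  have h2 : t ≤ t.factorial := Nat.self_le_factorial t
  have h3 : 2 ^ m ≤ d ^ m := Nat.pow_le_pow_left hd m
  nlinarith [Nat.factorial_pos t]

/-- Two transversal partitions into `M` blocks of size `m` and `m` blocks of size `M`. -/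
theorem schattenInfNorm_transversal_le {d t m M : ℕ} (hd : 2 ≤ d) {V ι κ : Type} [Fintype V]
    [DecidableEq V] [Fintype ι] [DecidableEq ι] [Fintype κ] [DecidableEq κ] (f : V → ι)
    (g : V → κ) (h : Function.Bijective fun v => (f v, g v)) (hι : Fintype.card ι = M)
    (hκ : Fintype.card κ = m) (hm : 1 ≤ m) (hmM : m ≤ M)
    (h1 : 3 * M * (t.factorial : ℝ) ≤ 2 ^ m) (h2 : 4 * (t.factorial : ℝ) ^ 2 ≤ 2 ^ m)
    (h3 : 2304 * (M : ℝ) ^ 2 * (t.factorial : ℝ) ^ 4 ≤ 2 ^ M) :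
    schattenInfNorm (haarProjectorOnBlocks d t g * haarProjectorOnBlocks d t f -
      haarProjector d t V) ≤ 1 / (d : ℝ) ^ (1 / 4 * (M : ℝ)) := by
  have hT : (1 : ℝ) ≤ t.factorial := by exact_mod_cast Nat.factorial_pos t
  have hd0 : (0 : ℝ) < d := by exact_mod_cast (by omega : 0 < d)
  have hq0 : (0 : ℝ) < (d : ℝ)⁻¹ := inv_pos.2 hd0
  have hq : (d : ℝ)⁻¹ ≤ 1 / 2 := by
    rw [one_div]
    exact inv_anti₀ (by norm_num) (by exact_mod_cast hd)
  have htm := le_pow_of_four_mul_sq_le hd h2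
  have hmono : ∀ n, m ≤ n → t ≤ d ^ n := fun n hn =>
    htm.trans (Nat.pow_le_pow_right (by omega) hn)
  have hVcard : Fintype.card V = M * m := by
    rw [Fintype.card_of_bijective h, Fintype.card_prod, hι, hκ]
  have hMT : M * ((t.factorial : ℝ) * ((d : ℝ)⁻¹) ^ m) ≤ 1 / 3 := by
    have h2qm : 2 ^ m * ((d : ℝ)⁻¹) ^ m ≤ 1 := by
      rw [← mul_pow]; exact pow_le_one₀ (by positivity) (by linarith)
    have : 3 * M * (t.factorial : ℝ) * ((d : ℝ)⁻¹) ^ m ≤ 2 ^ m * ((d : ℝ)⁻¹) ^ m := by gcongr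
    linarith
  have hmT : m * ((t.factorial : ℝ) * ((d : ℝ)⁻¹) ^ M) ≤ 1 / 3 := by
    refine le_trans ?_ hMT
    have : ((d : ℝ)⁻¹) ^ M ≤ ((d : ℝ)⁻¹) ^ m := pow_le_pow_of_le_one hq0.le (by linarith) hmM
    gcongr
  subst hι hκ
  refine (schattenInfNorm_blocks_le (by omega) f g h htm (hmono _ hmM) (hmono _ ?_) ?_ ?_
    (overlap_sum_le hq0 hq hT hm hmM h1 h2)).trans (four_mul_sqrt_le hd h3)
  · rw [hVcard]
    exact Nat.le_mul_of_pos_left _ (by omega)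
  · linarith [one_add_pow_sub_one_le (by positivity) _ hMT]
  · linarith [one_add_pow_sub_one_le (by positivity) _ hmT]

theorem card_ne_fun {D m : ℕ} (α : Fin D) :
    Fintype.card ({β : Fin D // β ≠ α} → Fin m) = m ^ (D - 1) := by
  simp [Fintype.card_subtype_compl]

theorem bijective_row_plane {D m : ℕ} (α : Fin D) :
    Function.Bijective fun x : QuditLattice D m =>
      ((fun β : {β : Fin D // β ≠ α} => x β), x α) := by
  constructor
  · intro x y hxy
    funext β
    by_cases hβ : β = α
    · subst hβ; exact congrArg Prod.snd hxy
    · exact congrFun (congrArg Prod.fst hxy) ⟨β, hβ⟩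
  · rintro ⟨r, p⟩
    refine ⟨fun β => if hβ : β = α then p else r ⟨β, hβ⟩, Prod.ext ?_ ?_⟩
    · funext β
      simp [β.2]
    · simp

theorem bijective_row_column {m : ℕ} :
    Function.Bijective fun x : QuditLattice 2 m =>
      ((fun β : {β : Fin 2 // β ≠ 0} => x β), (fun β : {β : Fin 2 // β ≠ 1} => x β)) := by
  constructor
  · intro x y hxy
    funext β
    fin_cases β
    · exact congrFun (congrArg Prod.snd hxy) ⟨0, by simp⟩
    · exact congrFun (congrArg Prod.fst hxy) ⟨1, by simp⟩
  · rintro ⟨r, p⟩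
    refine ⟨![p ⟨0, by simp⟩, r ⟨1, by simp⟩], Prod.ext ?_ ?_⟩
    · funext β
      obtain ⟨β, hβ⟩ := β
      fin_cases β
      · exact absurd rfl hβ
      · rfl
    · funext β
      obtain ⟨β, hβ⟩ := β
      fin_cases β
      · rfl
      · exact absurd rfl hβ

/-- The dimension bound makes the side length at least `(ln n)²`. -/
theorem log_sq_le_of_dimension_le {D m : ℕ} (hD : 1 ≤ D) (hn : Real.exp 1 < ((m ^ D : ℕ) : ℝ))
    (h : (D : ℝ) ≤ 1 / 2 * (Real.log ((m ^ D : ℕ) : ℝ) / Real.log (Real.log ((m ^ D : ℕ) : ℝ)))) :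
    Real.log ((m ^ D : ℕ) : ℝ) ^ 2 ≤ m := by
  set L := Real.log ((m ^ D : ℕ) : ℝ) with hL
  have hn0 : (0 : ℝ) < ((m ^ D : ℕ) : ℝ) := (Real.exp_pos 1).trans hn
  have hL1 : 1 < L := (Real.lt_log_iff_exp_lt hn0).2 hn
  have hLL : 0 < Real.log L := Real.log_pos hL1
  have hm0 : 0 < m := by
    rcases Nat.eq_zero_or_pos m with rfl | hm
    · rw [zero_pow (by omega)] at hn0; simp at hn0
    · exact hm
  have hLm : L = D * Real.log m := by rw [hL, Nat.cast_pow, Real.log_pow]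
  have hD0 : (0 : ℝ) < D := by exact_mod_cast hD
  -- The constant 1/2 in the dimension bound becomes this factor 2, hence the square of the
  -- logarithm.
  have h1 : D * (2 * Real.log L) ≤ D * Real.log m := by
    rw [← hLm]
    have : (D : ℝ) ≤ L / (2 * Real.log L) := by
      refine h.trans (le_of_eq ?_)
      field_simp
    rwa [le_div_iff₀ (by positivity)] at this
  have h2 : Real.log (L ^ 2) ≤ Real.log m := by
    rw [Real.log_pow]
    exact le_of_mul_le_mul_left (by exact_mod_cast h1) hD0
  exact (Real.log_le_log_iff (by positivity) (by exact_mod_cast hm0)).1 h2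

end Lattices

/-! ### The main theorem -/

theorem mainTheorem5 :
    (∃ c : ℝ, 0 < c ∧ ∀ t : ℕ, 1 ≤ t → ∃ n₀ : ℕ, ∀ d : ℕ, 2 ≤ d →
      ∀ n m : ℕ, n = m ^ 2 → n₀ ≤ n →
        schattenInfNorm (projC d t m * projR d t m - haarProjector d t (QuditLattice 2 m))
          ≤ 1 / (d : ℝ) ^ (c * √(n : ℝ))) ∧
    (∃ c₀ : ℝ, 0 < c₀ ∧ ∃ c : ℝ, 0 < c ∧ ∀ t : ℕ, 1 ≤ t → ∃ n₀ : ℕ, ∀ d : ℕ, 2 ≤ d →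
      ∀ (D : ℕ) (α : Fin D) (n m : ℕ), n = m ^ D → n₀ ≤ n →
        (D : ℝ) ≤ c₀ * (Real.log n / Real.log (Real.log n)) →
          schattenInfNorm
              (planesProjector d t m α * rowsProjector d t m α - haarProjector d t (QuditLattice D m))
            ≤ 1 / (d : ℝ) ^ (c * (n : ℝ) ^ (1 - 1 / (D : ℝ)))) := by
  refine ⟨⟨1 / 4, by norm_num, fun t _ => ?_⟩,
    ⟨1 / 2, by norm_num, 1 / 4, by norm_num, fun t _ => ?_⟩⟩
  · obtain ⟨m₀, hm₀, H⟩ := exists_threshold (T := t.factorial)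
      (by exact_mod_cast Nat.factorial_pos t)
    refine ⟨m₀ ^ 2, ?_⟩
    rintro d hd _ m rfl hn
    have hm : m₀ ≤ m := (Nat.pow_le_pow_iff_left (by norm_num)).1 hn
    obtain ⟨h1, h2, h3⟩ := H m hm m le_rfl (le_exp_sqrt m)
    rw [Nat.cast_pow, Real.sqrt_sq (Nat.cast_nonneg m)]
    exact schattenInfNorm_transversal_le hd _ _ bijective_row_column
      (by rw [card_ne_fun]; simp) (by rw [card_ne_fun]; simp) (hm₀.trans hm) le_rfl h1 h2 h3
  · obtain ⟨m₀, hm₀, H⟩ := exists_threshold (T := t.factorial)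
      (by exact_mod_cast Nat.factorial_pos t)
    -- `ln n > 1` makes `ln ln n` positive, and `ln n > √m₀` gives `m ≥ (ln n)² ≥ m₀`.
    obtain ⟨n₁, hn₁⟩ := exists_nat_gt (Real.exp (max 1 √m₀))
    refine ⟨n₁, ?_⟩
    rintro d hd D α _ m rfl hn hdim
    have hD : 1 ≤ D := by have := α.2; omega
    have hn' : Real.exp (max 1 √m₀) < ((m ^ D : ℕ) : ℝ) :=
      hn₁.trans_le (by exact_mod_cast hn)
    have hn0 : (0 : ℝ) < ((m ^ D : ℕ) : ℝ) := (Real.exp_pos _).trans hn'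
    have hlog := (Real.lt_log_iff_exp_lt hn0).2 hn'
    have hlogm : Real.log ((m ^ D : ℕ) : ℝ) ^ 2 ≤ m := log_sq_le_of_dimension_le hD
      ((Real.exp_le_exp.2 (le_max_left _ _)).trans_lt hn') hdim
    have hm : m₀ ≤ m := by
      have h1 : √(m₀ : ℝ) ^ 2 ≤ Real.log ((m ^ D : ℕ) : ℝ) ^ 2 :=
        pow_le_pow_left₀ (Real.sqrt_nonneg _) ((le_max_right _ _).trans hlog.le) 2
      rw [Real.sq_sqrt (Nat.cast_nonneg _)] at h1
      exact_mod_cast h1.trans hlogm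
    have hm1 : 1 ≤ m := hm₀.trans hm
    -- For `D = 1` there is one row, the whole lattice, and the difference vanishes. The general
    -- estimate does not apply: `M = 1` need not be at least `m`, and a plane is a single site,
    -- whose dimension may be below `t`.
    rcases Nat.eq_or_lt_of_le hD with rfl | hD2
    · have h4 := (H m hm m le_rfl (le_exp_sqrt m)).2.1
      have : IsEmpty {β : Fin 1 // β ≠ α} := ⟨fun β => β.2 (Subsingleton.elim _ _)⟩
      rw [planesProjector, rowsProjector, haarProjectorOnBlocks_mul_eq_haarProjector _ _
        (by simpa using le_pow_of_four_mul_sq_le hd h4), sub_self, schattenInfNorm, map_zero,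
        norm_zero]
      positivity
    · have hM : ((m ^ (D - 1) : ℕ) : ℝ) ≤ Real.exp √m := by
        have h5 : Real.log ((m ^ D : ℕ) : ℝ) ≤ √m := Real.le_sqrt_of_sq_le hlogm
        have h6 : ((m ^ (D - 1) : ℕ) : ℝ) ≤ ((m ^ D : ℕ) : ℝ) := by
          exact_mod_cast Nat.pow_le_pow_right hm1 (Nat.sub_le D 1)
        exact h6.trans ((Real.log_le_iff_le_exp hn0).1 h5)
      have hmM : m ≤ m ^ (D - 1) := Nat.le_self_pow (by omega) m
      obtain ⟨h1, h2, h3⟩ := H m hm _ hmM hM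
      have hexp : ((m ^ D : ℕ) : ℝ) ^ (1 - 1 / (D : ℝ)) = ((m ^ (D - 1) : ℕ) : ℝ) := by
        rw [Nat.cast_pow, Nat.cast_pow, ← Real.rpow_natCast, ← Real.rpow_mul (Nat.cast_nonneg m),
          ← Real.rpow_natCast, Nat.cast_sub hD]
        congr 1
        have : (D : ℝ) ≠ 0 := by positivity
        field_simp
        simp
      rw [hexp]
      exact schattenInfNorm_transversal_le hd _ _ (bijective_row_plane α) (card_ne_fun α)
        (Fintype.card_fin m) hm1 hmM h1 h2 h3
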